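/- Let $N\ge 1$ and $n,m\ge 0$ be integers. Agent $i\in\{1,\dots,N\}$ chooses $x_i\in\Omega_i\subseteq\mathbb R^n$ and has a cost $f_i:\mathbb R^n\times\mathbb R^n\to\mathbb R\cup\{\infty\}$, evaluated at its own strategy and at the average strategy. For $p\in\mathbb N$ and $\boldsymbol z=(z_1,\dots,z_N)\in(\mathbb R^{p})^N$ write $\hat z=M_p\boldsymbol z=\frac1N\sum_i z_i$. Let $A_i\in\mathbb R^{m\times n}$, $b_i\in\mathbb R^m$, $A=[A_1,\dots,A_N]$, $b=\sum_i b_i$, and $\boldsymbol{\mathcal X}=\{\boldsymbol x\in\prod_i\Omega_i : A\boldsymbol x\le b\}$. All subdifferentials below are convex subdifferentials, empty outside the effective domain, and normal cones $\mathrm N_S(x)$ are empty for $x\notin S$. **Assumptions.** 1. Every $\Omega_i$ is nonempty, compact and convex, and $\boldsymbol{\mathcal X}$ satisfies Slater's condition: there is $\boldsymbol x$ with $x_i$ in the relative interior of $\Omega_i$ for all $i$ and $A\boldsymbol x\le b$ (the constraints being affine, strict inequality is not required). 2. For all $i$ and all $x_j\in\Omega_j$ $(j\ne i)$, the functions $z\mapsto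 f_i\big(z,\frac1N(z+\sum_{j\neq i}x_j)\big)$ and $z\mapsto f_i\big(z,\frac1N\sum_{j\ne i}x_j\big)$ are convex. For every $i$ and every $\sigma\in\mathbb R^n$, $f_i(\cdot,\sigma)$ is finite on a neighbourhood of $\Omega_i$. 3. With $F_{\rm e}(\boldsymbol x,\sigma)=\prod_{i}\partial_{x_i}f_i(x_i,\sigma)$, the operator $(\boldsymbol x,\sigma)\mapsto F_{\rm e}(\boldsymbol x,\sigma)\times\{0\}$ on $\mathbb R^{nN+n}$ is maximally monotone. **Algorithm.** Let $\gamma_i>0$, $\hat\gamma=\frac1N\sum_i\gamma_i$, $\alpha>0$, $\delta_{\rm c}\in(0,1/\hat\gamma)$ and $\beta_{\rm c}\in\big(0,1/(\alpha+\hat\gamma/N)\big)$. Start from any $x_i^0\in\Omega_i$ and $\lambda^0\in\mathbb R^m_{\ge0}$, with $y_i^0=A_ix_i^0-b_i$, $\sigma^0=M_n\boldsymbol x^0$ and $\mu^0=0$. For $k\ge0$ set $$x_i^{k+1}=\operatorname*{argmin}_{z\in\Omega_i}\ f_i(z,\sigma^k)+\big(A_i^\top\lambda^k-\tfrac1N\mu^k\big)^\top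 z+\tfrac1{2\gamma_i}\|z-x_i^k\|^2_{I+A_i^\top A_i},\qquad y_i^{k+1}=A_ix_i^{k+1}-b_i,$$ $$\lambda^{k+1}=\mathrm{proj}_{\mathbb R^m_{\ge0}}\big(\lambda^k+\delta_{\rm c}(2\hat y^{k+1}-\hat y^k)\big),$$ $$\mu^{k+1}=\mu^k-\beta_{\rm c}\big(2\hat x^{k+1}-\hat x^k-\sigma^k+\alpha\mu^k\big),\qquad \sigma^{k+1}=\sigma^k-\alpha\mu^{k+1}.$$ **Operator.** Let $\boldsymbol C=\{(\boldsymbol x,\boldsymbol y): x_i\in\Omega_i,\ y_i=A_ix_i-b_i\ \forall i\}$, and let $\mathcal T(\boldsymbol x,\boldsymbol y,\sigma,\mu,\lambda)$ be the set of all $$\big(g+u-M_n^\top\mu,\ \ v+(\lambda,\dots,\lambda),\ \ \mu,\ \ -(\sigma-M_n\boldsymbol x),\ \ r-\textstyle\sum_i y_i\big)$$ with $g\in F_{\rm e}(\boldsymbol x,\sigma)$, $(u,v)\in \mathrm N_{\boldsymbol C}(\boldsymbol x,\boldsymbol y)$ and $r\in \mathrm N_{\mathbb R^m_{\ge0}}(\lambda)$.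 **Theorem.** Under Assumptions 1-3, for all such step sizes and all such initial points, the algorithm generates exactly one sequence $(\boldsymbol x^k,\boldsymbol y^k,\sigma^k,\mu^k,\lambda^k)_{k\ge0}$, and this sequence converges to some $(\boldsymbol x^*,\boldsymbol y^*,\sigma^*,\mu^*,\lambda^*)$ with $0\in\mathcal T(\boldsymbol x^*,\boldsymbol y^*,\sigma^*,\mu^*,\lambda^*)$. Moreover $\boldsymbol x^*$ is a variational generalized aggregative equilibrium. That is, (a) $\boldsymbol x^*\in\boldsymbol{\mathcal X}$, and for all $i$ and all $z\in\Omega_i$ with $A_iz-b_i\le\sum_{j\ne i}(b_j-A_jx_j^*)$ one has $f_i(x_i^*,M_n\boldsymbol x^*)\le f_i(z,M_n\boldsymbol x^*)$; and (b) there is $g\in F_{\rm e}(\boldsymbol x^*,M_n\boldsymbol x^*)$ with $g^\top(\boldsymbol x-\boldsymbol x^*)\ge0$ for all $\boldsymbol x\in\boldsymbol{\mathcal X}$. -/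

import Mathlib

open Set Filter Topology

noncomputable section

/-! ### Operator-theoretic notions -/

/-- Effective domain of an extended-real-valued function. -/
def effDom {H : Type*} (φ : H → EReal) : Set H := {x | φ x < ⊤}

/-- Convexity of an extended-real-valued function: its epigraph is convex. -/
def ConvexFun {H : Type*} [AddCommGroup H] [Module ℝ H] (φ : H → EReal) : Prop :=
  Convex ℝ {p : H × ℝ | φ p.1 ≤ (p.2 : EReal)}

/-- Convex subdifferential; it is empty outside the effective domain. -/
def subdiff {H : Type*} [NormedAddCommGroup H] [InnerProductSpace ℝ H]
    (φ : H → EReal) (x : H) : Set H :=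
  {v | x ∈ effDom φ ∧ ∀ z ∈ effDom φ, φ x + ((inner ℝ v (z - x) : ℝ) : EReal) ≤ φ z}

/-- Normal cone of `S` at `x`; it is empty if `x ∉ S`. -/
def normalCone {H : Type*} [NormedAddCommGroup H] [InnerProductSpace ℝ H]
    (S : Set H) (x : H) : Set H :=
  {v | x ∈ S ∧ ∀ z ∈ S, inner ℝ v (z - x) ≤ 0}

/-- Maximal monotonicity of a set-valued operator: it is monotone, and its graph is contained
in no strictly larger monotone graph. -/
def MaximallyMonotone {H : Type*} [NormedAddCommGroup H] [InnerProductSpace ℝ H]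
    (F : H → Set H) : Prop :=
  (∀ x y, ∀ u ∈ F x, ∀ v ∈ F y, 0 ≤ inner ℝ (u - v) (x - y)) ∧
  ∀ x u, (∀ y, ∀ v ∈ F y, 0 ≤ inner ℝ (u - v) (x - y)) → u ∈ F x

/-- Zeros of a set-valued operator. -/
def zer {H : Type*} [Zero H] (F : H → Set H) : Set H := {x | 0 ∈ F x}

/-- Set of minimizers of `φ` over `S`. -/
def argminOn {H : Type*} (S : Set H) (φ : H → EReal) : Set H :=
  {x | x ∈ S ∧ ∀ z ∈ S, φ x ≤ φ z}

/-- Set of nearest points of `S` to `u` (one point if `S` is nonempty, closed and convex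
in a Euclidean space). -/
def projOn {H : Type*} [NormedAddCommGroup H] (S : Set H) (u : H) : Set H :=
  {p | p ∈ S ∧ ∀ q ∈ S, ‖p - u‖ ≤ ‖q - u‖}

/-- `x` solves the generalized variational inequality GVI(`W`, `Ψ`). -/
def SolvesGVI {H : Type*} [NormedAddCommGroup H] [InnerProductSpace ℝ H]
    (W : Set H) (Ψ : H → Set H) (x : H) : Prop :=
  x ∈ W ∧ ∃ g ∈ Ψ x, ∀ z ∈ W, 0 ≤ inner ℝ g (z - x)

/-! ### Spaces -/

/-- Euclidean `ℝⁿ`. -/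
abbrev Vec (n : ℕ) := EuclideanSpace ℝ (Fin n)

/-- Euclidean `ℝ^{nN}`, as `N` blocks of length `n`. -/
abbrev Prof (N n : ℕ) := PiLp 2 (fun _ : Fin N => Vec n)

/-- Nonnegative orthant of `ℝᵐ`. -/
def nonnegOrthant (m : ℕ) : Set (Vec m) := {l | ∀ j, 0 ≤ l j}

/-- Action of a matrix on Euclidean vectors. -/
def mulV {p q : ℕ} (B : Matrix (Fin p) (Fin q) ℝ) (z : Vec q) : Vec p :=
  Matrix.toEuclideanLin B z

/-- Squared weighted norm `‖v‖²_Q = vᵀ Q v`. -/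
def wNormSq {q : ℕ} (Q : Matrix (Fin q) (Fin q) ℝ) (v : Vec q) : ℝ := inner ℝ v (mulV Q v)

/-- Average of the blocks, `M_p z = (1/N) ∑ᵢ zᵢ`. -/
def avg {N p : ℕ} (z : Prof N p) : Vec p := (1 / (N : ℝ)) • ∑ i, z i

/-- The vector with all blocks equal to `w`, i.e. `(1_N ⊗ I_p) w`. -/
def rep (N : ℕ) {p : ℕ} (w : Vec p) : Prof N p := WithLp.toLp 2 (fun _ => w)

/-- The space `ℝᵈ`, `d = nN + mN + 2n + m`, of the variables `(x, y, σ, μ, λ)`. -/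
abbrev State (N n m : ℕ) := Prof N n × Prof N m × Vec n × Vec n × Vec m

namespace State

variable {N n m : ℕ}

/-- Strategies. -/
abbrev x (w : State N n m) : Prof N n := w.1
/-- Auxiliary local variables. -/
abbrev y (w : State N n m) : Prof N m := w.2.1
/-- Strategy of the coordinator. -/
abbrev σ (w : State N n m) : Vec n := w.2.2.1
/-- Multiplier of `σ = M_n x`. -/
abbrev μ (w : State N n m) : Vec n := w.2.2.2.1
/-- Multiplier of the coupling constraint. -/
abbrev lam (w : State N n m) : Vec m := w.2.2.2.2

end State

/-! ### Generalized aggregative games -/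

/-- Data of an average aggregative game with `N` agents, strategies in `ℝⁿ` and `m` affine
coupling constraints `∑ᵢ Aᵢ xᵢ ≤ ∑ᵢ bᵢ`. The cost functions take values in `ℝ ∪ {∞}`. -/
structure AggGame (N n m : ℕ) where
  /-- local decision sets -/
  Ω : Fin N → Set (Vec n)
  /-- cost functions of (own strategy, average strategy) -/
  f : Fin N → Vec n → Vec n → EReal
  /-- the value `-∞` is not taken -/
  f_ne_bot : ∀ i z s, f i z s ≠ ⊥
  /-- blocks of the coupling matrix -/
  A : Fin N → Matrix (Fin m) (Fin n) ℝ
  /-- local parts of the right-hand side of the coupling constraints -/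
  b : Fin N → Vec m

namespace AggGame

variable {N n m : ℕ} (G : AggGame N n m)

/-- `A x - b`. -/
def coupling (x : Prof N n) : Vec m := ∑ i, mulV (G.A i) (x i) - ∑ i, G.b i

/-- Collective feasible set. -/
def X : Set (Prof N n) := {x | (∀ i, x i ∈ G.Ω i) ∧ ∀ j, G.coupling x j ≤ 0}

/-- Feasible set of agent `i`, given the strategies of the others. -/
def Xi (i : Fin N) (x : Prof N n) : Set (Vec n) :=
  {z | z ∈ G.Ω i ∧ ∀ j, (mulV (G.A i) z - G.b i) j ≤
    (∑ k ∈ Finset.univ.erase i, (G.b k - mulV (G.A k) (x k))) j}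

/-- `Jᵢ(z, x₋ᵢ) = fᵢ(z, (1/N) (z + ∑_{k ≠ i} x_k))`. -/
def J (i : Fin N) (z : Vec n) (x : Prof N n) : EReal :=
  G.f i z ((1 / (N : ℝ)) • (z + ∑ k ∈ Finset.univ.erase i, x k))

/-- Generalized aggregative equilibrium. -/
def IsGAE (x : Prof N n) : Prop :=
  x ∈ G.X ∧ ∀ i, ∀ z ∈ G.Xi i x, G.f i (x i) (avg x) ≤ G.f i z (avg x)

/-- Extended pseudo-subdifferential `F_e`. -/
def Fe (x : Prof N n) (s : Vec n) : Set (Prof N n) :=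
  {g | ∀ i, g i ∈ subdiff (fun z => G.f i z s) (x i)}

/-- `F_a(x)`: the subdifferentials `∂_{xᵢ} fᵢ(xᵢ, z)` evaluated at `z = M_n x`. -/
def Fa (x : Prof N n) : Set (Prof N n) := G.Fe x (avg x)

/-- Variational generalized aggregative equilibrium: an equilibrium that
solves GVI(`X`, `F_a`). -/
def IsVGAE (x : Prof N n) : Prop := G.IsGAE x ∧ SolvesGVI G.X G.Fa x

/-- The operator `F_e × ∂_σ f_c` on `ℝ^{nN+n}`, where `f_c = 0` and so `∂_σ f_c = {0}`. -/
def FeFc (w : WithLp 2 (Prof N n × Vec n)) : Set (WithLp 2 (Prof N n × Vec n)) :=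
  {v | v.fst ∈ G.Fe w.fst w.snd ∧ v.snd = 0}

/-- `C = {(x, y) | xᵢ ∈ Ωᵢ, yᵢ = Aᵢ xᵢ - bᵢ for all i}`. -/
def C : Set (WithLp 2 (Prof N n × Prof N m)) :=
  {w | ∀ i, w.fst i ∈ G.Ω i ∧ w.snd i = mulV (G.A i) (w.fst i) - G.b i}

/-- The KKT operator of the extended game. The pair of blocks `(∂_x ι_C, ∂_y ι_C)` is the
normal cone of `C` in the joint variable `(x, y)`; the coupling constraint of the extended game
is `∑ᵢ yᵢ ≤ 0`, with multiplier `λ`. -/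
def T (w : State N n m) : Set (State N n m) :=
  {t | ∃ g ∈ G.Fe w.x w.σ,
      ∃ c ∈ normalCone G.C (WithLp.toLp 2 (w.x, w.y)),
      ∃ r ∈ normalCone (nonnegOrthant m) w.lam,
        t = (g + c.fst - (1 / (N : ℝ)) • rep N w.μ,
             c.snd + rep N w.lam,
             w.μ,
             -(w.σ - avg w.x),
             r - ∑ i, w.y i)}

/-- Compact convex local sets, and Slater's constraint qualification: as the coupling
constraints are affine, they need not be strict at the Slater point, which lies in the relative
interior of the local sets. -/
structure CompactConvexSlater : Prop where
  nonempty : ∀ i, (G.Ω i).Nonempty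
  compact : ∀ i, IsCompact (G.Ω i)
  convex : ∀ i, Convex ℝ (G.Ω i)
  slater : ∃ x : Prof N n, (∀ i, x i ∈ intrinsicInterior ℝ (G.Ω i)) ∧ ∀ j, G.coupling x j ≤ 0

/-- Convexity of the costs in the local variable. -/
structure ConvexCosts : Prop where
  J_convex : ∀ i (x : Prof N n), (∀ k, k ≠ i → x k ∈ G.Ω k) → ConvexFun (fun z => G.J i z x)
  f_convex : ∀ i (x : Prof N n), (∀ k, k ≠ i → x k ∈ G.Ω k) →
    ConvexFun (fun z => G.f i z ((1 / (N : ℝ)) • ∑ k ∈ Finset.univ.erase i, x k))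

/-- The costs are finite on a neighbourhood of the local decision sets. -/
def FiniteCosts : Prop := ∀ i s, G.Ω i ⊆ interior (effDom (fun z => G.f i z s))

end AggGame

/-! ### The algorithm -/

/-- Mean of the local step sizes. -/
def meanStep {N : ℕ} (γ : Fin N → ℝ) : ℝ := (1 / (N : ℝ)) * ∑ i, γ i

/-- Admissible step sizes. -/
structure StepSizes (N : ℕ) where
  γ : Fin N → ℝ
  α : ℝ
  δc : ℝ
  βc : ℝ
  γ_pos : ∀ i, 0 < γ i
  α_pos : 0 < α
  δc_mem : δc ∈ Ioo 0 (1 / meanStep γ)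
  βc_mem : βc ∈ Ioo 0 (1 / (α + meanStep γ / N))

namespace AggGame

variable {N n m : ℕ} (G : AggGame N n m)

/-- Objective of the local strategy update of agent `i` in the state `w`. -/
def localObj (p : StepSizes N) (w : State N n m) (i : Fin N) (z : Vec n) : EReal :=
  G.f i z w.σ +
    ((inner ℝ (mulV (G.A i).transpose w.lam - (1 / (N : ℝ)) • w.μ) z
      + 1 / (2 * p.γ i) * wNormSq (1 + (G.A i).transpose * G.A i) (z - w.x i) : ℝ) : EReal)

/-- Admissible initial states. -/
structure IsInit (w : State N n m) : Prop where
  x_mem : ∀ i, w.x i ∈ G.Ω i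
  y_eq : ∀ i, w.y i = mulV (G.A i) (w.x i) - G.b i
  σ_eq : w.σ = avg w.x
  μ_eq : w.μ = 0
  lam_mem : w.lam ∈ nonnegOrthant m

/-- One iteration of the semi-decentralized Douglas-Rachford algorithm, from `w` to `w'`. -/
structure IsStep (p : StepSizes N) (w w' : State N n m) : Prop where
  x_mem : ∀ i, w'.x i ∈ argminOn (G.Ω i) (G.localObj p w i)
  y_eq : ∀ i, w'.y i = mulV (G.A i) (w'.x i) - G.b i
  lam_mem : w'.lam ∈
    projOn (nonnegOrthant m) (w.lam + p.δc • ((2 : ℝ) • avg w'.y - avg w.y))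
  μ_eq : w'.μ = w.μ - p.βc • ((2 : ℝ) • avg w'.x - avg w.x - w.σ + p.α • w.μ)
  σ_eq : w'.σ = w.σ - p.α • w'.μ

/-- The sequence `ω` is generated by the algorithm from the initial state `w₀`. -/
def Generates (p : StepSizes N) (w₀ : State N n m) (ω : ℕ → State N n m) : Prop :=
  ω 0 = w₀ ∧ ∀ k, G.IsStep p (ω k) (ω (k + 1))

end AggGame

end

/-! The second component of `F_e × {0}` is always zero, so the monotonicity inequality does not see
where σ is evaluated. Maximality then forces the subdifferential of `f_i(·, σ)` to be the same for
every σ. Convex functions with equal nonempty subdifferentials differ by a constant, so on `Ω_i` one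
has `f_i(z, σ) = φ_i(z) + c_i(σ)` (`exists_isPotential`). The game is thus a separable convex
program: minimize `∑ φ_i(x_i)` over `Ω_i` subject to the coupling constraints.

Its primal-dual solutions, together with σ = avg x and μ = 0, are the points `IsKKT`. One exists by
compactness and by Lagrange duality for affine constraints under the weak Slater condition
(`exists_multipliers`).

Since `y_i = A_i x_i - b_i` along the iteration, only (x, σ, μ, λ) matters. In these variables the
algorithm is a proximal-point method in the metric `precForm`, and the step-size bounds make that
form positive definite. Each step brings the iterate closer to every KKT point (`precForm_step_le`),
cluster points are KKT (`isKKT_of_tendsto`), and Fejér monotonicity gives convergence of the whole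
sequence.

Optimality is kept as inequalities between values of φ, which add up and pass to limits by
continuity. Subgradients are extracted only at the limit, where they give the zero of the operator
and the equilibrium property. -/

noncomputable section

/-! ### Lagrange duality for affine constraints. -/

/-- A real function that respects all affine combinations of two points. -/
def RespectsAffine {E : Type*} [AddCommGroup E] [Module ℝ E] (l : E → ℝ) : Prop :=
  ∀ (x y : E) (a b : ℝ), a + b = 1 → l (a • x + b • y) = a * l x + b * l y

/-- Every segment of `S` that ends at `x₀` can be prolonged beyond `x₀` inside `S`. -/
def ProlongableAt {E : Type*} [AddCommGroup E] [Module ℝ E] (S : Set E) (x₀ : E) : Prop :=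
  x₀ ∈ S ∧ ∀ x ∈ S, ∃ t : ℝ, 0 < t ∧ (1 + t) • x₀ + (-t) • x ∈ S

section Duality

variable {E : Type*} [AddCommGroup E] [Module ℝ E]

theorem RespectsAffine.convexOn {l : E → ℝ} (hl : RespectsAffine l) {S : Set E}
    (hS : Convex ℝ S) : ConvexOn ℝ S l :=
  ⟨hS, fun x _ y _ a b _ _ hab => by simp [hl x y a b hab]⟩

theorem RespectsAffine.const_mul {l : E → ℝ} (hl : RespectsAffine l) (c : ℝ) :
    RespectsAffine (fun x => c * l x) := fun x y a b hab => by
  simp only [hl x y a b hab]; ring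

theorem RespectsAffine.add {l l' : E → ℝ} (hl : RespectsAffine l) (hl' : RespectsAffine l') :
    RespectsAffine (fun x => l x + l' x) := fun x y a b hab => by
  simp only [hl x y a b hab, hl' x y a b hab]; ring

theorem RespectsAffine.sum {ι : Type*} (s : Finset ι) {l : ι → E → ℝ}
    (hl : ∀ i ∈ s, RespectsAffine (l i)) : RespectsAffine (fun x => ∑ i ∈ s, l i x) :=
  fun x y a b hab => by
  rw [Finset.mul_sum, Finset.mul_sum, ← Finset.sum_add_distrib]
  exact Finset.sum_congr rfl fun i hi => hl i hi x y a b hab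

/-- A positive value at x would become negative at the prolongation of the segment beyond x₀. -/
theorem ProlongableAt.eq_zero {S : Set E} {x₀ : E} (h₀ : ProlongableAt S x₀) {l : E → ℝ}
    (hl : RespectsAffine l) (hnn : ∀ x ∈ S, 0 ≤ l x) (hz : l x₀ = 0) : ∀ x ∈ S, l x = 0 := by
  intro x hx
  obtain ⟨t, ht, hm⟩ := h₀.2 x hx
  have h1 := hnn _ hm
  rw [hl _ _ _ _ (by ring), hz] at h1
  have h2 := hnn x hx
  nlinarith

/-- Convexity across a zero of an affine function. -/
theorem ConvexOn.cross_slope {S : Set E} {φ l : E → ℝ} (hφ : ConvexOn ℝ S φ)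
    (hl : RespectsAffine l) (h : ∀ x ∈ S, l x = 0 → 0 ≤ φ x) {x y : E} (hx : x ∈ S) (hy : y ∈ S)
    (hlx : 0 < l x) (hly : l y < 0) : -φ x / l x ≤ φ y / (-l y) := by
  have hd : 0 < l x - l y := by linarith
  -- These weights give the point of the segment at which l vanishes.
  have ha : 0 ≤ -l y / (l x - l y) := div_nonneg (by linarith) hd.le
  have hb : 0 ≤ l x / (l x - l y) := div_nonneg hlx.le hd.le
  have hab : -l y / (l x - l y) + l x / (l x - l y) = 1 := by
    rw [← add_div, div_eq_one_iff_eq hd.ne']; ring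
  have h0 := h _ (hφ.1 hx hy ha hb hab) (by
    rw [hl _ _ _ _ hab]; field_simp; ring)
  have h1 := hφ.2 hx hy ha hb hab
  simp only [smul_eq_mul] at h1
  have h2 : 0 ≤ (-l y * φ x + l x * φ y) / (l x - l y) := by
    refine (h0.trans h1).trans_eq ?_
    field_simp
  have h3 : 0 ≤ -l y * φ x + l x * φ y := by
    by_contra hc
    exact absurd h2 (not_le.2 (div_neg_of_neg_of_pos (not_le.1 hc) hd))
  rw [div_le_div_iff₀ hlx (by linarith)]
  linarith

/-- Lagrange multiplier of one affine equality with points on both sides. -/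
theorem ConvexOn.exists_multiplier_of_two_sided {S : Set E} {φ l : E → ℝ} (hφ : ConvexOn ℝ S φ)
    (hl : RespectsAffine l) (h : ∀ x ∈ S, l x = 0 → 0 ≤ φ x) (hpos : ∃ x ∈ S, 0 < l x)
    (hneg : ∃ x ∈ S, l x < 0) : ∃ κ : ℝ, ∀ x ∈ S, 0 ≤ φ x + κ * l x := by
  obtain ⟨p, hp, hlp⟩ := hpos
  obtain ⟨q, hq, hlq⟩ := hneg
  -- Every slope from the side l < 0 bounds all slopes from the side l > 0, so the supremum of the
  -- latter works on both sides.
  set P : Set ℝ := (fun x => -φ x / l x) '' {x ∈ S | 0 < l x} with hP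
  have hPne : P.Nonempty := ⟨_, p, ⟨hp, hlp⟩, rfl⟩
  have hub : ∀ y ∈ S, l y < 0 → φ y / (-l y) ∈ upperBounds P := by
    rintro y hy hly _ ⟨x, ⟨hx, hlx⟩, rfl⟩
    exact hφ.cross_slope hl h hx hy hlx hly
  refine ⟨sSup P, fun x hx => ?_⟩
  rcases lt_trichotomy (l x) 0 with hlx | hlx | hlx
  · have := csSup_le hPne (hub x hx hlx)
    rw [le_div_iff₀ (by linarith)] at this
    linarith
  · simpa [hlx] using h x hx hlx
  · have : -φ x / l x ≤ sSup P := le_csSup ⟨_, hub q hq hlq⟩ ⟨x, ⟨hx, hlx⟩, rfl⟩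
    rw [div_le_iff₀ hlx] at this
    linarith

/-- Lagrange multiplier of one affine inequality with a strictly feasible point. -/
theorem ConvexOn.exists_multiplier_of_strict {S : Set E} {φ l : E → ℝ} (hφ : ConvexOn ℝ S φ)
    (hl : RespectsAffine l) (h : ∀ x ∈ S, l x ≤ 0 → 0 ≤ φ x)
    (hneg : ∃ x ∈ S, l x < 0) : ∃ κ : ℝ, 0 ≤ κ ∧ ∀ x ∈ S, 0 ≤ φ x + κ * l x := by
  by_cases hpos : ∃ x ∈ S, 0 < l x
  · obtain ⟨κ, hκ⟩ := hφ.exists_multiplier_of_two_sided hl (fun x hx h0 => h x hx h0.le) hpos hneg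
    rcases le_total 0 κ with hk | hk
    · exact ⟨κ, hk, hκ⟩
    -- With κ ≤ 0 the term κ l is nonpositive where l ≥ 0, so φ is already nonnegative there.
    · refine ⟨0, le_rfl, fun x hx => ?_⟩
      rcases le_total (l x) 0 with h0 | h0
      · simpa using h x hx h0
      · have := hκ x hx
        nlinarith
  · push Not at hpos
    exact ⟨0, le_rfl, fun x hx => by simpa using h x hx (hpos x hx)⟩

/-- Lagrange multiplier of one affine equality that holds at a relatively interior point. -/
theorem ConvexOn.exists_multiplier_of_prolongable {S : Set E} {φ l : E → ℝ}
    (hφ : ConvexOn ℝ S φ) (hl : RespectsAffine l) {x₀ : E} (h₀ : ProlongableAt S x₀)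
    (hz : l x₀ = 0) (h : ∀ x ∈ S, l x = 0 → 0 ≤ φ x) :
    ∃ κ : ℝ, ∀ x ∈ S, 0 ≤ φ x + κ * l x := by
  by_cases hall : ∀ x ∈ S, l x = 0
  · exact ⟨0, fun x hx => by simpa using h x hx (hall x hx)⟩
  push Not at hall
  obtain ⟨x, hx, hne⟩ := hall
  obtain ⟨t, ht, hm⟩ := h₀.2 x hx
  have hv : l ((1 + t) • x₀ + (-t) • x) = -t * l x := by
    rw [hl _ _ _ _ (by ring), hz]; ring
  rcases lt_or_gt_of_ne hne with hlt | hgt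
  · exact hφ.exists_multiplier_of_two_sided hl h ⟨_, hm, by rw [hv]; nlinarith⟩ ⟨x, hx, hlt⟩
  · exact hφ.exists_multiplier_of_two_sided hl h ⟨x, hx, hgt⟩ ⟨_, hm, by rw [hv]; nlinarith⟩

theorem convex_inter_nonpos {ι : Type*} (s : Finset ι) {S : Set E} (hS : Convex ℝ S)
    {l : ι → E → ℝ} (hl : ∀ i, RespectsAffine (l i)) :
    Convex ℝ {x ∈ S | ∀ i ∈ s, l i x ≤ 0} := by
  intro x hx y hy a b ha hb hab
  refine ⟨hS hx.1 hy.1 ha hb hab, fun i hi => ?_⟩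
  rw [hl i _ _ _ _ hab]
  have := hx.2 i hi
  have := hy.2 i hi
  nlinarith

/-- Strong Lagrange duality for finitely many affine inequalities that hold at a relatively
interior point of the ground set. -/
theorem exists_multipliers {ι : Type*} [DecidableEq ι] {l : ι → E → ℝ}
    (hl : ∀ i, RespectsAffine (l i)) {x₀ : E} (s : Finset ι) :
    ∀ (S : Set E) (φ : E → ℝ), ConvexOn ℝ S φ → ProlongableAt S x₀ → (∀ i ∈ s, l i x₀ ≤ 0) →
      (∀ x ∈ S, (∀ i ∈ s, l i x ≤ 0) → 0 ≤ φ x) →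
      ∃ c : ι → ℝ, (∀ i, 0 ≤ c i) ∧ ∀ x ∈ S, 0 ≤ φ x + ∑ i ∈ s, c i * l i x := by
  induction s using Finset.induction_on with
  | empty =>
    intro S φ _ _ _ h
    exact ⟨0, fun _ => le_rfl, fun x hx => by simpa using h x hx (by simp)⟩
  | insert a s has ih =>
    intro S φ hφ h₀ hfeas h
    have hfeas' : ∀ i ∈ s, l i x₀ ≤ 0 := fun i hi => hfeas i (Finset.mem_insert_of_mem hi)
    have hupd : ∀ (c : ι → ℝ) (κ : ℝ) (x : E),
        ∑ i ∈ insert a s, (Function.update c a κ) i * l i x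
          = κ * l a x + ∑ i ∈ s, c i * l i x := by
      intro c κ x
      rw [Finset.sum_insert has, Function.update_self]
      congr 1
      refine Finset.sum_congr rfl fun i hi => ?_
      rw [Function.update_of_ne (by rintro rfl; exact has hi)]
    have hupd0 : ∀ (c : ι → ℝ) (κ : ℝ), (∀ i, 0 ≤ c i) → 0 ≤ κ →
        ∀ i, 0 ≤ Function.update c a κ i := by
      intro c κ hc hκ i
      by_cases hi : i = a
      · subst hi; simpa using hκ
      · simpa [hi] using hc i
    by_cases hst : ∃ x ∈ {x ∈ S | ∀ i ∈ s, l i x ≤ 0}, l a x < 0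
    -- Constraint a can be strict: dualize it first, over the points satisfying the others, and then
    -- apply induction to φ + κ l_a.
    · obtain ⟨κ, hκ, hk⟩ := ConvexOn.exists_multiplier_of_strict
        (hφ.subset (fun _ hx => hx.1) (convex_inter_nonpos s hφ.1 hl)) (hl a)
        (fun x hx h0 => h x hx.1 (by
          intro i hi
          rcases Finset.mem_insert.1 hi with rfl | hi
          exacts [h0, hx.2 i hi])) hst
      obtain ⟨c, hc, hcx⟩ := ih S (fun x => φ x + κ * l a x)
        (hφ.add (((hl a).const_mul κ).convexOn hφ.1)) h₀ hfeas' (fun x hx hi => hk x ⟨hx, hi⟩)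
      refine ⟨Function.update c a κ, hupd0 c κ hc hκ, fun x hx => ?_⟩
      rw [hupd, ← add_assoc]
      exact hcx x hx
    · push Not at hst
      -- Now l_a ≥ 0 wherever the other constraints hold. Induction with objective l_a gives l_a + ∑
      -- ν_i l_i ≥ 0 on S. This function is ≤ 0 at x₀, hence zero on all of S, and l_a acts as an
      -- equality constraint.
      obtain ⟨ν, hν, hνx⟩ := ih S (l a) ((hl a).convexOn hφ.1) h₀ hfeas'
        (fun x hx hi => hst x ⟨hx, hi⟩)
      have hsum0 : ∑ i ∈ s, ν i * l i x₀ ≤ 0 :=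
        Finset.sum_nonpos fun i hi => mul_nonpos_of_nonneg_of_nonpos (hν i) (hfeas' i hi)
      have ha0 : l a x₀ ≤ 0 := hfeas a (Finset.mem_insert_self a s)
      have hx₀ := hνx x₀ h₀.1
      have hdep := h₀.eq_zero (l := fun x => l a x + ∑ i ∈ s, ν i * l i x)
        ((hl a).add (RespectsAffine.sum s fun i _ => (hl i).const_mul (ν i))) hνx
        (le_antisymm (by linarith) hx₀)
      have haz : l a x₀ = 0 := by linarith
      have hS' : Convex ℝ {x ∈ S | l a x = 0} := by
        intro x hx y hy u v hu hv huv
        exact ⟨hφ.1 hx.1 hy.1 hu hv huv, by rw [hl a _ _ _ _ huv, hx.2, hy.2]; simp⟩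
      have h₀' : ProlongableAt {x ∈ S | l a x = 0} x₀ := by
        refine ⟨⟨h₀.1, haz⟩, fun x hx => ?_⟩
        obtain ⟨t, ht, hm⟩ := h₀.2 x hx.1
        exact ⟨t, ht, hm, by rw [hl a _ _ _ _ (by ring), haz, hx.2]; simp⟩
      obtain ⟨c, hc, hcx⟩ := ih {x ∈ S | l a x = 0} φ (hφ.subset (fun _ hx => hx.1) hS') h₀' hfeas'
        (fun x hx hi => h x hx.1 (by
          intro i hi'
          rcases Finset.mem_insert.1 hi' with rfl | hi'
          exacts [hx.2.le, hi i hi']))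
      have hφc : ConvexOn ℝ S (fun x => φ x + ∑ i ∈ s, c i * l i x) :=
        hφ.add ((RespectsAffine.sum s fun i _ => (hl i).const_mul (c i)).convexOn hφ.1)
      obtain ⟨κ, hκ⟩ := hφc.exists_multiplier_of_prolongable (hl a) h₀ haz
        (fun x hx h0 => hcx x ⟨hx, h0⟩)
      rcases le_total 0 κ with hk | hk
      · refine ⟨Function.update c a κ, hupd0 c κ hc hk, fun x hx => ?_⟩
        rw [hupd]
        linarith [hκ x hx]
      -- A multiplier of the wrong sign is moved to the other constraints through l_a = -∑ ν_i l_i.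
      · refine ⟨Function.update (fun i => c i + (-κ) * ν i) a 0,
          hupd0 _ _ (fun i => add_nonneg (hc i) (mul_nonneg (by linarith) (hν i))) le_rfl,
          fun x hx => ?_⟩
        rw [hupd]
        have h1 := hκ x hx
        have h2 : l a x = -∑ i ∈ s, ν i * l i x := by linarith [hdep x hx]
        have h3 : ∑ i ∈ s, (c i + -κ * ν i) * l i x
            = ∑ i ∈ s, c i * l i x + (-κ) * ∑ i ∈ s, ν i * l i x := by
          rw [Finset.mul_sum, ← Finset.sum_add_distrib]
          exact Finset.sum_congr rfl fun i _ => by ring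
        rw [h3]
        rw [h2] at h1
        linarith

end Duality

/-! ### Relative interiors and subgradients. -/

/-- Points of the intrinsic interior are stable under small prolongations. -/
theorem eventually_prolong_mem {E : Type*} [NormedAddCommGroup E] [NormedSpace ℝ E] {S : Set E}
    {x₀ x : E} (h₀ : x₀ ∈ intrinsicInterior ℝ S) (hx : x ∈ S) :
    ∀ᶠ t : ℝ in 𝓝 0, (1 + t) • x₀ + (-t) • x ∈ S := by
  obtain ⟨y, hy, rfl⟩ := h₀
  let z : affineSpan ℝ S := ⟨x, subset_affineSpan ℝ S hx⟩
  have hmem : ∀ t : ℝ, (1 + t) • (y : E) + (-t) • x ∈ affineSpan ℝ S := by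
    intro t
    have := AffineMap.lineMap_mem (-t) y.2 z.2
    convert this using 1
    rw [AffineMap.lineMap_apply_module]
    simp [z]
  let g : ℝ → affineSpan ℝ S := fun t => ⟨(1 + t) • (y : E) + (-t) • x, hmem t⟩
  have hg : Continuous g := by
    refine Continuous.subtype_mk ?_ _
    fun_prop
  have hg0 : g 0 = y := Subtype.ext (by simp [g])
  have : interior ((↑) ⁻¹' S : Set (affineSpan ℝ S)) ∈ 𝓝 (g 0) := by
    rw [hg0]; exact isOpen_interior.mem_nhds hy
  filter_upwards [hg.continuousAt.preimage_mem_nhds this] with t ht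
  exact (interior_subset ht : _)

theorem coe_toReal_of_mem_effDom {H : Type*} {f : H → EReal} (hbot : ∀ x, f x ≠ ⊥) {x : H}
    (hx : x ∈ effDom f) : ((f x).toReal : EReal) = f x :=
  EReal.coe_toReal (ne_of_lt hx) (hbot x)

section Subgradient

variable {H : Type*} [NormedAddCommGroup H] [InnerProductSpace ℝ H]

theorem mem_subdiff_iff {f : H → EReal} (hbot : ∀ x, f x ≠ ⊥) {x v : H} (hx : x ∈ effDom f) :
    v ∈ subdiff f x ↔ ∀ z ∈ effDom f, (f x).toReal + inner ℝ v (z - x) ≤ (f z).toReal := by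
  refine ⟨fun h z hz => ?_, fun h => ⟨hx, fun z hz => ?_⟩⟩
  · have := h.2 z hz
    rw [← coe_toReal_of_mem_effDom hbot hx, ← coe_toReal_of_mem_effDom hbot hz] at this
    exact_mod_cast this
  · rw [← coe_toReal_of_mem_effDom hbot hx, ← coe_toReal_of_mem_effDom hbot hz]
    exact_mod_cast h z hz

theorem ConvexFun.convexOn_toReal {f : H → EReal} (hf : ConvexFun f) (hbot : ∀ x, f x ≠ ⊥) :
    ConvexOn ℝ (effDom f) (fun x => (f x).toReal) := by
  have key : ∀ x ∈ effDom f, ∀ y ∈ effDom f, ∀ a b : ℝ, 0 ≤ a → 0 ≤ b → a + b = 1 →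
      f (a • x + b • y) ≤ ((a * (f x).toReal + b * (f y).toReal : ℝ) : EReal) := by
    intro x hx y hy a b ha hb hab
    have h1 : (x, (f x).toReal) ∈ {p : H × ℝ | f p.1 ≤ (p.2 : EReal)} :=
      (coe_toReal_of_mem_effDom hbot hx).ge
    have h2 : (y, (f y).toReal) ∈ {p : H × ℝ | f p.1 ≤ (p.2 : EReal)} :=
      (coe_toReal_of_mem_effDom hbot hy).ge
    have := hf h1 h2 ha hb hab
    simpa using this
  refine ⟨fun x hx y hy a b ha hb hab =>
    lt_of_le_of_lt (key x hx y hy a b ha hb hab) (EReal.coe_lt_top _),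
    fun x hx y hy a b ha hb hab => ?_⟩
  have h := key x hx y hy a b ha hb hab
  have hd : a • x + b • y ∈ effDom f := lt_of_le_of_lt h (EReal.coe_lt_top _)
  rw [← coe_toReal_of_mem_effDom hbot hd] at h
  simpa using EReal.coe_le_coe_iff.1 h

/-- First-order optimality: if `f + ⟪h, ·⟫` is minimal over `S` at `x`, some subgradient `g` of
`f` at `x` satisfies the variational inequality of `g + h` over `S`. -/
theorem exists_subgradient_of_minimizer [FiniteDimensional ℝ H] {f : H → EReal}
    (hf : ConvexFun f) (hbot : ∀ x, f x ≠ ⊥) {S : Set H} (hS : Convex ℝ S)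
    (hint : S ⊆ interior (effDom f)) {x : H} (hx : x ∈ S) (h : H)
    (hmin : ∀ z ∈ S, (f x).toReal ≤ (f z).toReal + inner ℝ h (z - x)) :
    ∃ g ∈ subdiff f x, ∀ z ∈ S, 0 ≤ inner ℝ (g + h) (z - x) := by
  set r : H → ℝ := fun z => (f z).toReal with hr
  have hrc : ConvexOn ℝ (effDom f) r := hf.convexOn_toReal hbot
  set U := interior (effDom f) with hU
  have hUc : Convex ℝ U := hrc.1.interior
  have hrU : ConvexOn ℝ U r := hrc.subset interior_subset hUc
  have hcont : ContinuousOn r U := hrU.continuousOn isOpen_interior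
  -- Separate the open strict epigraph of f over the interior of its domain from the part over S
  -- below the affine function f(x) - ⟪h, · - x⟫. Minimality makes the two disjoint.
  let A : Set (H × ℝ) := {p | p.1 ∈ U ∧ r p.1 < p.2}
  have hAc : Convex ℝ A := hrU.convex_strict_epigraph
  have hAo : IsOpen A := by
    have h1 : ContinuousOn (fun p : H × ℝ => p.2 - r p.1) (U ×ˢ univ) :=
      continuousOn_snd.sub (hcont.comp continuousOn_fst fun p hp => hp.1)
    have h2 := h1.isOpen_inter_preimage (isOpen_interior.prod isOpen_univ) (isOpen_Ioi (a := 0))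
    convert h2 using 1
    ext p
    simp [A]
  let B : Set (H × ℝ) := {p | p.1 ∈ S ∧ p.2 ≤ r x - inner ℝ h (p.1 - x)}
  have hBc : Convex ℝ B := by
    intro p hp q hq a b ha hb hab
    refine ⟨hS hp.1 hq.1 ha hb hab, ?_⟩
    have h1 := mul_le_mul_of_nonneg_left hp.2 ha
    have h2 := mul_le_mul_of_nonneg_left hq.2 hb
    have h3 : inner ℝ h ((a • p + b • q).1 - x)
        = a * inner ℝ h (p.1 - x) + b * inner ℝ h (q.1 - x) := by
      have : (a • p + b • q).1 - x = a • (p.1 - x) + b • (q.1 - x) := by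
        obtain rfl : b = 1 - a := by linarith
        simp only [Prod.fst_add, Prod.smul_fst]
        module
      rw [this, inner_add_right, inner_smul_right, inner_smul_right]
    rw [h3]
    have h4 : r x = a * r x + b * r x := by rw [← add_mul, hab, one_mul]
    simp only [Prod.snd_add, Prod.smul_snd, smul_eq_mul]
    linarith
  have hdis : Disjoint A B := by
    rw [Set.disjoint_left]
    rintro ⟨z, t⟩ hA hB
    have h1 : r z < t := hA.2
    have h2 : t ≤ r x - inner ℝ h (z - x) := hB.2
    have h3 := hmin z hB.1
    simp only [hr] at h1 h2
    linarith
  obtain ⟨F, u, hFA, hFB⟩ := geometric_hahn_banach_open hAc hAo hBc hdis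
  set τ : ℝ := F (0, 1) with hτ
  let P : H →L[ℝ] ℝ := F.comp (ContinuousLinearMap.inl ℝ H ℝ)
  have hF : ∀ z t, F (z, t) = P z + t * τ := by
    intro z t
    have : (z, t) = (z, (0 : ℝ)) + t • ((0 : H), (1 : ℝ)) := by simp
    rw [this, map_add, map_smul]
    simp [P, hτ]
  have hxU : x ∈ U := hint hx
  have hxB : u ≤ P x + r x * τ := by
    have := hFB (x, r x) ⟨hx, by simp⟩
    rwa [hF] at this
  -- The hyperplane is not vertical because x is interior to the domain.
  have hτneg : τ < 0 := by
    have := hFA (x, r x + 1) ⟨hxU, by simp⟩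
    rw [hF] at this
    nlinarith
  have hUle : ∀ z ∈ U, P z + r z * τ ≤ u := by
    intro z hz
    refine le_of_forall_pos_le_add fun ε hε => ?_
    have h1 := hFA (z, r z + ε / (-τ)) ⟨hz, by
      have : 0 < ε / (-τ) := div_pos hε (by linarith)
      simpa using this⟩
    rw [hF] at h1
    have h2 : ε / (-τ) * τ = -ε := by
      rw [div_neg, neg_mul, div_mul_cancel₀ _ hτneg.ne]
    linarith [add_mul (r z) (ε / (-τ)) τ]
  let g : H := (InnerProductSpace.toDual ℝ H).symm ((-τ)⁻¹ • P)
  have hg : ∀ z, inner ℝ g z = (-τ)⁻¹ * P z := by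
    intro z
    simp only [g, map_smul, real_inner_smul_left, InnerProductSpace.toDual_symm_apply]
  have hgτ : ∀ z, P z = -τ * inner ℝ g z := by
    intro z
    have := hτneg.ne
    rw [hg]; field_simp
  have hsubU : ∀ z ∈ U, r x + inner ℝ g (z - x) ≤ r z := by
    intro z hz
    have h1 := (hUle z hz).trans hxB
    have h2 : P z = P x + -τ * inner ℝ g (z - x) := by
      rw [← hgτ, map_sub]; ring
    rw [h2] at h1
    nlinarith
  refine ⟨g, (mem_subdiff_iff hbot (interior_subset hxU)).2 fun z hz => ?_, fun z hz => ?_⟩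
  -- The subgradient inequality is known near x; convexity along the segment from x carries it to
  -- the whole effective domain.
  · have hc : Continuous fun t : ℝ => (1 - t) • x + t • z := by fun_prop
    have hev : ∀ᶠ t : ℝ in 𝓝 0, (1 - t) • x + t • z ∈ U := by
      refine hc.continuousAt.preimage_mem_nhds ?_
      have : U ∈ 𝓝 x := isOpen_interior.mem_nhds hxU
      simpa only [sub_zero, one_smul, zero_smul, add_zero] using this
    have hev' : ∀ᶠ t : ℝ in 𝓝[>] 0, (1 - t) • x + t • z ∈ U := hev.filter_mono nhdsWithin_le_nhds
    obtain ⟨t, ⟨htU, ht1⟩, ht0⟩ := ((hev'.and (eventually_nhdsWithin_of_eventually_nhds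
      (eventually_lt_nhds (zero_lt_one (α := ℝ))))).and self_mem_nhdsWithin).exists
    have ht0 : 0 < t := ht0
    have h1 := hsubU _ htU
    have h2 := hrc.2 (interior_subset hxU) hz (by linarith : 0 ≤ 1 - t) ht0.le (by ring)
    have h3 : (1 - t) • x + t • z - x = t • (z - x) := by module
    rw [h3, inner_smul_right] at h1
    simp only [smul_eq_mul] at h2
    simp only [hr] at h1 h2 ⊢
    nlinarith
  · have h1 := hxB
    have h2 := (hFB (z, r x - inner ℝ h (z - x)) ⟨hz, le_rfl⟩)
    rw [hF] at h2
    have h3 := hUle x hxU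
    have h4 : P z = P x + -τ * inner ℝ g (z - x) := by
      rw [← hgτ, map_sub]; ring
    rw [inner_add_left]
    rw [h4] at h2
    nlinarith

theorem subdiff_nonempty_of_mem_interior [FiniteDimensional ℝ H] {f : H → EReal}
    (hf : ConvexFun f) (hbot : ∀ x, f x ≠ ⊥) {x : H} (hx : x ∈ interior (effDom f)) :
    (subdiff f x).Nonempty := by
  obtain ⟨g, hg, -⟩ := exists_subgradient_of_minimizer hf hbot (convex_singleton x)
    (by simpa using hx) rfl 0 (by simp)
  exact ⟨g, hg⟩

/-- Cut the segment into n + 1 equal pieces, bounding r with the subgradient at the left end of each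
piece and r' with the one at the right end. The sum telescopes to an error of order 1/(n + 1), so no
differentiability is needed. -/
theorem sub_le_sub_of_common_subgradients {S : Set H} (hS : Convex ℝ S) {D : H → Set H}
    (hD : ∀ x ∈ S, (D x).Nonempty) {r r' : H → ℝ}
    (hr : ∀ x ∈ S, ∀ z ∈ S, ∀ g ∈ D x, r x + inner ℝ g (z - x) ≤ r z)
    (hr' : ∀ x ∈ S, ∀ z ∈ S, ∀ g ∈ D x, r' x + inner ℝ g (z - x) ≤ r' z)
    {x z : H} (hx : x ∈ S) (hz : z ∈ S) : r x - r' x ≤ r z - r' z := by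
  choose! G hG using hD
  have key : ∀ n : ℕ, inner ℝ (G x - G z) (z - x) * (1 / ((n : ℝ) + 1))
      ≤ (r z - r' z) - (r x - r' x) := by
    intro n
    have hn : (0 : ℝ) < (n : ℝ) + 1 := by positivity
    let p : ℕ → H := fun k => x + ((k : ℝ) / ((n : ℝ) + 1)) • (z - x)
    have hpS : ∀ k ≤ n + 1, p k ∈ S := by
      intro k hk
      have hk' : (k : ℝ) ≤ (n : ℝ) + 1 := by exact_mod_cast hk
      exact hS.add_smul_sub_mem hx hz ⟨by positivity, (div_le_one hn).2 hk'⟩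
    have hstep : ∀ k, p (k + 1) - p k = (1 / ((n : ℝ) + 1)) • (z - x) := by
      intro k
      simp only [p]
      push_cast
      rw [add_div]
      module
    have hsum : ∀ k ≤ n + 1, inner ℝ (G (p 0) - G (p k)) (z - x) * (1 / ((n : ℝ) + 1))
        ≤ (r (p k) - r' (p k)) - (r (p 0) - r' (p 0)) := by
      intro k
      induction k with
      | zero => intro; simp
      | succ k ih =>
        intro hk
        have h0 := ih (by omega)
        have h1 := hr _ (hpS k (by omega)) _ (hpS (k + 1) hk) _ (hG _ (hpS k (by omega)))
        have h2 := hr' _ (hpS (k + 1) hk) _ (hpS k (by omega)) _ (hG _ (hpS (k + 1) hk))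
        have h3 : p k - p (k + 1) = -((1 / ((n : ℝ) + 1)) • (z - x)) := by
          rw [← hstep k]; abel
        rw [hstep, inner_smul_right] at h1
        rw [h3, inner_neg_right, inner_smul_right] at h2
        rw [inner_sub_left] at h0 ⊢
        linarith
    have h0 : p 0 = x := by simp [p]
    have h1 : p (n + 1) = z := by
      simp only [p]
      push_cast
      rw [div_self hn.ne']
      simp
    simpa only [h0, h1] using hsum (n + 1) le_rfl
  have hlim : Tendsto (fun n : ℕ => inner ℝ (G x - G z) (z - x) * (1 / ((n : ℝ) + 1))) atTop
      (𝓝 (inner ℝ (G x - G z) (z - x) * 0)) :=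
    tendsto_one_div_add_atTop_nhds_zero_nat.const_mul _
  linarith [le_of_tendsto' hlim key]

/-- Functions with the same nonempty subdifferentials on a convex set differ by a constant. -/
theorem sub_eq_sub_of_common_subgradients {S : Set H} (hS : Convex ℝ S) {D : H → Set H}
    (hD : ∀ x ∈ S, (D x).Nonempty) {r r' : H → ℝ}
    (hr : ∀ x ∈ S, ∀ z ∈ S, ∀ g ∈ D x, r x + inner ℝ g (z - x) ≤ r z)
    (hr' : ∀ x ∈ S, ∀ z ∈ S, ∀ g ∈ D x, r' x + inner ℝ g (z - x) ≤ r' z)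
    {x z : H} (hx : x ∈ S) (hz : z ∈ S) : r x - r' x = r z - r' z :=
  le_antisymm (sub_le_sub_of_common_subgradients hS hD hr hr' hx hz)
    (sub_le_sub_of_common_subgradients hS hD hr hr' hz hx)

end Subgradient

/-! ### Reduction of the game to a potential. -/

namespace AggGame

variable {N n m : ℕ} (G : AggGame N n m)

/-- Operator values have zero second component, so replacing s by s' leaves all monotonicity
inequalities unchanged; maximality then admits the new pair. -/
theorem mem_Fe_of_mem_Fe (hmono : MaximallyMonotone G.FeFc) {x g : Prof N n} {s : Vec n}
    (hg : g ∈ G.Fe x s) (s' : Vec n) : g ∈ G.Fe x s' := by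
  have h := hmono.2 (WithLp.toLp 2 (x, s')) (WithLp.toLp 2 (g, 0)) (fun y v hv => ?_)
  · exact h.1
  have h1 := hmono.1 (WithLp.toLp 2 (x, s)) y (WithLp.toLp 2 (g, 0)) ⟨hg, rfl⟩ v hv
  rw [WithLp.prod_inner_apply] at h1 ⊢
  have h2 : v.snd = 0 := hv.2
  simpa [h2] using h1

theorem exists_mem_Fe (hmono : MaximallyMonotone G.FeFc) : ∃ x g s, g ∈ G.Fe x s := by
  by_contra! hne
  have h := hmono.2 0 0 (fun y v hv => (hne _ _ _ hv.1).elim)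
  exact hne _ _ _ h.1

/-- Maximal monotonicity of `F_e × {0}` makes the local subdifferentials independent of the
aggregate. -/
theorem subdiff_indep (hmono : MaximallyMonotone G.FeFc) (i : Fin N) {z v : Vec n} {s : Vec n}
    (hv : v ∈ subdiff (fun z => G.f i z s) z) (s' : Vec n) :
    v ∈ subdiff (fun z => G.f i z s') z := by
  -- Membership in `Fe` needs a subgradient for every agent at once, so the other blocks are
  -- borrowed from an arbitrary point of the graph, moved to the aggregate s.
  obtain ⟨x, g, t, hg⟩ := G.exists_mem_Fe hmono
  have hg' := G.mem_Fe_of_mem_Fe hmono hg s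
  have h : (WithLp.toLp 2 (Function.update g i v) : Prof N n) ∈
      G.Fe (WithLp.toLp 2 (Function.update x i z)) s := by
    intro k
    by_cases hk : k = i
    · subst hk; simpa using hv
    · simpa [hk] using hg' k
  simpa using G.mem_Fe_of_mem_Fe hmono h s' i

/-- `φ` represents the costs on the local sets up to constants that depend on the aggregate. -/
structure IsPotential (φ : Fin N → Vec n → ℝ) : Prop where
  convexOn : ∀ i, ConvexOn ℝ (G.Ω i) (φ i)
  continuousOn : ∀ i, ContinuousOn (φ i) (G.Ω i)
  cost_eq : ∀ i s, ∃ c : ℝ, ∀ z ∈ G.Ω i, G.f i z s = ((φ i z + c : ℝ) : EReal)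
  exists_subgradient : ∀ i, ∀ x ∈ G.Ω i, ∀ h : Vec n,
    (∀ z ∈ G.Ω i, φ i x ≤ φ i z + inner ℝ h (z - x)) →
    ∃ g, (∀ s, g ∈ subdiff (fun z => G.f i z s) x) ∧ ∀ z ∈ G.Ω i, 0 ≤ inner ℝ (g + h) (z - x)

theorem exists_isPotential (hΩ : G.CompactConvexSlater) (hconv : G.ConvexCosts)
    (hfin : G.FiniteCosts) (hmono : MaximallyMonotone G.FeFc) : ∃ φ, G.IsPotential φ := by
  choose p hp using hΩ.nonempty
  -- Convexity in the own variable is assumed only at aggregates of this form, so the potential is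
  -- the cost frozen at one of them.
  let s₀ : Fin N → Vec n := fun i => (1 / (N : ℝ)) • ∑ k ∈ Finset.univ.erase i, p k
  have hcf : ∀ i, ConvexFun fun z => G.f i z (s₀ i) := fun i =>
    hconv.f_convex i (WithLp.toLp 2 p) fun k _ => hp k
  have hbot : ∀ i s z, G.f i z s ≠ ⊥ := fun i s z => G.f_ne_bot i z s
  have hdom : ∀ i s, G.Ω i ⊆ effDom fun z => G.f i z s := fun i s =>
    (hfin i s).trans interior_subset
  refine ⟨fun i z => (G.f i z (s₀ i)).toReal, ?_, ?_, ?_, ?_⟩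
  · intro i
    exact ((hcf i).convexOn_toReal (hbot i _)).subset (hdom i _) (hΩ.convex i)
  · intro i
    exact (((hcf i).convexOn_toReal (hbot i _)).continuousOn_interior).mono (hfin i _)
  · intro i s
    refine ⟨(G.f i (p i) s).toReal - (G.f i (p i) (s₀ i)).toReal, fun z hz => ?_⟩
    have hle : ∀ s', ∀ x ∈ G.Ω i, ∀ z ∈ G.Ω i, ∀ g ∈ subdiff (fun z => G.f i z (s₀ i)) x,
        (G.f i x s').toReal + inner ℝ g (z - x) ≤ (G.f i z s').toReal :=
      fun s' x hx z hz g hg => (mem_subdiff_iff (hbot i s') (hdom i s' hx)).1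
        (G.subdiff_indep hmono i hg s') z (hdom i s' hz)
    have h := sub_eq_sub_of_common_subgradients (hΩ.convex i)
      (fun x hx => subdiff_nonempty_of_mem_interior (hcf i) (hbot i _) (hfin i _ hx))
      (hle s) (hle (s₀ i)) hz (hp i)
    rw [← coe_toReal_of_mem_effDom (hbot i s) (hdom i s hz)]
    congr 1
    linarith
  · intro i x hx h hmin
    obtain ⟨g, hg, hgz⟩ := exists_subgradient_of_minimizer (hcf i) (hbot i _) (hΩ.convex i)
      (hfin i _) hx h hmin
    exact ⟨g, fun s => G.subdiff_indep hmono i hg s, hgz⟩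

end AggGame

/-! ### Local updates, projections, and well-posedness of the iteration. -/

section LinearAction

variable {p q : ℕ} (B : Matrix (Fin p) (Fin q) ℝ)

theorem mulV_add (v w : Vec q) : mulV B (v + w) = mulV B v + mulV B w := map_add _ v w

theorem mulV_sub (v w : Vec q) : mulV B (v - w) = mulV B v - mulV B w := map_sub _ v w

theorem mulV_smul (c : ℝ) (v : Vec q) : mulV B (c • v) = c • mulV B v := map_smul _ c v

theorem mulV_zero : mulV B 0 = 0 := map_zero _

theorem continuous_mulV : Continuous (mulV B) :=
  LinearMap.continuous_of_finiteDimensional (Matrix.toEuclideanLin B)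

theorem inner_mulV_transpose (l : Vec p) (z : Vec q) :
    inner ℝ (mulV B.transpose l) z = inner ℝ l (mulV B z) := by
  unfold mulV
  rw [← Matrix.conjTranspose_eq_transpose_of_trivial,
    Matrix.toEuclideanLin_conjTranspose_eq_adjoint, LinearMap.adjoint_inner_left]

theorem wNormSq_one_add (v : Vec q) :
    wNormSq (1 + B.transpose * B) v = inner ℝ v v + inner ℝ (mulV B v) (mulV B v) := by
  have h : mulV (1 + B.transpose * B) v = v + mulV B.transpose (mulV B v) := by
    ext j
    simp [mulV, Matrix.toLpLin_apply]
  rw [wNormSq, h, inner_add_right, real_inner_comm (mulV B.transpose _), inner_mulV_transpose]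

end LinearAction

theorem nonneg_of_quadratic {a K : ℝ} (h : ∀ t : ℝ, 0 < t → t ≤ 1 → 0 ≤ t * a + t ^ 2 * K) :
    0 ≤ a := by
  have hl : Tendsto (fun t : ℝ => a + t * K) (𝓝[>] 0) (𝓝 (a + 0 * K)) :=
    ((continuous_const.add (continuous_id.mul continuous_const)).tendsto 0).mono_left
      nhdsWithin_le_nhds
  rw [zero_mul, add_zero] at hl
  refine ge_of_tendsto hl ?_
  filter_upwards [self_mem_nhdsWithin, nhdsWithin_le_nhds (Iic_mem_nhds zero_lt_one)] with t h0 h1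
  have h0 : 0 < t := h0
  have := h t h0 h1
  by_contra hc
  push Not at hc
  nlinarith

/-- First-order condition along a segment for a convex function plus a quadratic. -/
theorem ConvexOn.le_of_min_add_quadratic {H : Type*} [AddCommGroup H] [Module ℝ H] {S : Set H}
    {φ q : H → ℝ} (hφ : ConvexOn ℝ S φ) {x z : H} (hx : x ∈ S) (hz : z ∈ S) {D K : ℝ}
    (hq : ∀ t : ℝ, q (x + t • (z - x)) = q x + t * D + t ^ 2 * K)
    (hmin : ∀ y ∈ S, φ x + q x ≤ φ y + q y) : φ x ≤ φ z + D := by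
  suffices 0 ≤ φ z - φ x + D by linarith
  refine nonneg_of_quadratic (K := K) fun t ht0 ht1 => ?_
  have h1 := hmin _ (hφ.1.add_smul_sub_mem hx hz ⟨ht0.le, ht1⟩)
  have h2 := hφ.2 hx hz (by linarith : 0 ≤ 1 - t) ht0.le (by ring)
  have h3 : (1 - t) • x + t • z = x + t • (z - x) := by module
  rw [h3] at h2
  rw [hq] at h1
  simp only [smul_eq_mul] at h2
  linarith

section Projection

variable {H : Type*} [NormedAddCommGroup H] [InnerProductSpace ℝ H]

theorem mem_projOn_iff {S : Set H} (hS : Convex ℝ S) {u p : H} :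
    p ∈ projOn S u ↔ p ∈ S ∧ ∀ q ∈ S, inner ℝ (u - p) (q - p) ≤ 0 := by
  have hb : BddBelow (range fun w : S => ‖u - w‖) := ⟨0, by rintro _ ⟨w, rfl⟩; positivity⟩
  refine and_congr_right fun hp => ?_
  rw [← norm_eq_iInf_iff_real_inner_le_zero hS hp]
  have : Nonempty S := ⟨⟨p, hp⟩⟩
  constructor
  · intro h
    refine le_antisymm (le_ciInf fun w => ?_) (ciInf_le hb ⟨p, hp⟩)
    rw [norm_sub_rev u p, norm_sub_rev u w]
    exact h w w.2
  · intro h q hq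
    rw [norm_sub_rev p u, norm_sub_rev q u, h]
    exact ciInf_le hb ⟨q, hq⟩

theorem existsUnique_mem_projOn {S : Set H} (hS : Convex ℝ S) (hne : S.Nonempty)
    (hc : IsComplete S) (u : H) : ∃! p, p ∈ projOn S u := by
  obtain ⟨p, hp, h⟩ := exists_norm_eq_iInf_of_complete_convex hne hc hS u
  rw [norm_eq_iInf_iff_real_inner_le_zero hS hp] at h
  refine ⟨p, (mem_projOn_iff hS).2 ⟨hp, h⟩, fun p' hp' => ?_⟩
  obtain ⟨hp'S, h'⟩ := (mem_projOn_iff hS).1 hp'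
  have h1 := h p' hp'S
  have h2 := h' p hp
  have h3 : inner ℝ (p' - p) (p' - p) ≤ (0 : ℝ) := by
    have : inner ℝ (p' - p) (p' - p)
        = inner ℝ (u - p) (p' - p) + inner ℝ (u - p') (p - p') := by
      rw [← neg_sub p' p, inner_neg_right, ← sub_eq_add_neg, ← inner_sub_left]
      congr 1
      abel
    linarith
  exact sub_eq_zero.1 (real_inner_self_nonpos.1 h3)

end Projection

theorem convex_nonnegOrthant (m : ℕ) : Convex ℝ (nonnegOrthant m) := by
  intro x hx y hy a b ha hb _ j
  have := mul_nonneg ha (hx j)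
  have := mul_nonneg hb (hy j)
  simp
  linarith

theorem isClosed_nonnegOrthant (m : ℕ) : IsClosed (nonnegOrthant m) := by
  have : nonnegOrthant m = ⋂ j, {l : Vec m | 0 ≤ l j} := by
    ext l; simp [nonnegOrthant]
  rw [this]
  exact isClosed_iInter fun j => isClosed_le continuous_const (by fun_prop)

namespace AggGame

variable {N n m : ℕ} {G : AggGame N n m} {φ : Fin N → Vec n → ℝ}

/-- Linear-quadratic part of the objective of the local update. -/
def localQuad (G : AggGame N n m) (p : StepSizes N) (w : State N n m) (i : Fin N)
    (z : Vec n) : ℝ :=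
  inner ℝ (mulV (G.A i).transpose w.lam - (1 / (N : ℝ)) • w.μ) z
    + 1 / (2 * p.γ i) * wNormSq (1 + (G.A i).transpose * G.A i) (z - w.x i)

theorem continuous_localQuad (G : AggGame N n m) (p : StepSizes N) (w : State N n m)
    (i : Fin N) : Continuous (G.localQuad p w i) := by
  unfold localQuad wNormSq
  have := continuous_mulV (1 + (G.A i).transpose * G.A i)
  fun_prop

theorem IsPotential.mem_argminOn_iff (hφ : G.IsPotential φ) (p : StepSizes N) (w : State N n m)
    (i : Fin N) (x : Vec n) :
    x ∈ argminOn (G.Ω i) (G.localObj p w i) ↔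
      x ∈ G.Ω i ∧ ∀ z ∈ G.Ω i, φ i x + G.localQuad p w i x ≤ φ i z + G.localQuad p w i z := by
  obtain ⟨c, hc⟩ := hφ.cost_eq i w.σ
  refine and_congr_right fun hx => forall₂_congr fun z hz => ?_
  have h : ∀ z ∈ G.Ω i, G.localObj p w i z = ((φ i z + c + G.localQuad p w i z : ℝ) : EReal) := by
    intro z hz
    rw [localObj, hc z hz, EReal.coe_add (φ i z + c)]
    rfl
  rw [h x hx, h z hz, EReal.coe_le_coe_iff]
  constructor <;> intro h <;> linarith

/-- First-order condition along segments. Keeping φ as a difference of values lets it cancel when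
two such inequalities are added. -/
theorem IsPotential.variational_of_argmin (hφ : G.IsPotential φ) {p : StepSizes N}
    {w : State N n m} {i : Fin N} {x : Vec n}
    (hx : x ∈ argminOn (G.Ω i) (G.localObj p w i)) {z : Vec n} (hz : z ∈ G.Ω i) :
    φ i x ≤ φ i z + (inner ℝ w.lam (mulV (G.A i) (z - x)) - 1 / (N : ℝ) * inner ℝ w.μ (z - x)
      + 1 / p.γ i * (inner ℝ (x - w.x i) (z - x)
        + inner ℝ (mulV (G.A i) (x - w.x i)) (mulV (G.A i) (z - x)))) := by
  rw [hφ.mem_argminOn_iff] at hx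
  refine (hφ.convexOn i).le_of_min_add_quadratic (q := G.localQuad p w i)
    (K := 1 / (2 * p.γ i) * (inner ℝ (z - x) (z - x)
      + inner ℝ (mulV (G.A i) (z - x)) (mulV (G.A i) (z - x)))) hx.1 hz (fun t => ?_) hx.2
  have hγ := (p.γ_pos i).ne'
  have h1 : x + t • (z - x) - w.x i = (x - w.x i) + t • (z - x) := by abel
  simp only [localQuad, wNormSq_one_add, h1, mulV_add (G.A i) (x - w.x i),
    mulV_smul (G.A i) t (z - x), inner_add_left, inner_add_right, inner_sub_left (mulV (G.A i).transpose _),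
    real_inner_smul_left, real_inner_smul_right, inner_mulV_transpose]
  rw [real_inner_comm (x - w.x i) (z - x),
    real_inner_comm (mulV (G.A i) (x - w.x i)) (mulV (G.A i) (z - x))]
  field_simp
  ring

theorem IsPotential.existsUnique_argmin (hφ : G.IsPotential φ) (hΩ : G.CompactConvexSlater)
    (p : StepSizes N) (w : State N n m) (i : Fin N) :
    ∃! x, x ∈ argminOn (G.Ω i) (G.localObj p w i) := by
  obtain ⟨x, hx, hmin⟩ := (hΩ.compact i).exists_isMinOn (hΩ.nonempty i)
    ((hφ.continuousOn i).add (G.continuous_localQuad p w i).continuousOn)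
  have hxm : x ∈ argminOn (G.Ω i) (G.localObj p w i) :=
    (hφ.mem_argminOn_iff p w i x).2 ⟨hx, fun z hz => hmin hz⟩
  refine ⟨x, hxm, fun x' hx' => ?_⟩
  -- Testing each of two minimizers at the other and adding leaves only the strongly convex
  -- quadratic term.
  have h1 := hφ.variational_of_argmin hxm hx'.1
  have h2 := hφ.variational_of_argmin hx' hx
  have e1 : x - x' = -(x' - x) := by abel
  have e2 : x' - w.x i = (x' - x) + (x - w.x i) := by abel
  have e3 : mulV (G.A i) (-(x' - x)) = -mulV (G.A i) (x' - x) := map_neg _ _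
  rw [e1, e2, e3, mulV_add, inner_add_left, inner_add_left] at h2
  simp only [inner_neg_right] at h2
  have hγ : 0 < 1 / p.γ i := one_div_pos.2 (p.γ_pos i)
  have h3 : 1 / p.γ i * (inner ℝ (x' - x) (x' - x)
      + inner ℝ (mulV (G.A i) (x' - x)) (mulV (G.A i) (x' - x))) ≤ 0 := by linarith
  have h4 : 0 ≤ inner ℝ (mulV (G.A i) (x' - x)) (mulV (G.A i) (x' - x)) :=
    real_inner_self_nonneg
  have h5 : inner ℝ (x' - x) (x' - x) ≤ (0 : ℝ) := by
    by_contra hc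
    push Not at hc
    exact absurd h3 (not_le.2 (mul_pos hγ (by linarith)))
  exact sub_eq_zero.1 (real_inner_self_nonpos.1 h5)

theorem IsPotential.existsUnique_step (hφ : G.IsPotential φ) (hΩ : G.CompactConvexSlater)
    (p : StepSizes N) (w : State N n m) : ∃! w', G.IsStep p w w' := by
  choose x hx hxu using hφ.existsUnique_argmin hΩ p w
  let x' : Prof N n := WithLp.toLp 2 x
  let y' : Prof N m := WithLp.toLp 2 fun i => mulV (G.A i) (x i) - G.b i
  obtain ⟨l, hl, hlu⟩ := existsUnique_mem_projOn (convex_nonnegOrthant m)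
    ⟨0, fun _ => le_rfl⟩ (isClosed_nonnegOrthant m).isComplete
    (w.lam + p.δc • ((2 : ℝ) • avg y' - avg w.y))
  let μ' : Vec n := w.μ - p.βc • ((2 : ℝ) • avg x' - avg w.x - w.σ + p.α • w.μ)
  refine ⟨(x', y', w.σ - p.α • μ', μ', l), ⟨hx, fun i => rfl, hl, rfl, rfl⟩, ?_⟩
  rintro ⟨x₁, y₁, s₁, μ₁, l₁⟩ ⟨h1, h2, h3, h4, h5⟩
  obtain rfl : x₁ = x' := by
    ext i : 1
    exact hxu i _ (h1 i)
  obtain rfl : y₁ = y' := by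
    ext i : 1
    exact h2 i
  obtain rfl : l₁ = l := hlu _ h3
  obtain rfl : μ₁ = μ' := h4
  obtain rfl : s₁ = w.σ - p.α • μ' := h5
  rfl

theorem IsPotential.existsUnique_generates (hφ : G.IsPotential φ) (hΩ : G.CompactConvexSlater)
    (p : StepSizes N) (w₀ : State N n m) : ∃! ω, G.Generates p w₀ ω := by
  choose s hs hsu using hφ.existsUnique_step hΩ p
  refine ⟨fun k => Nat.rec w₀ (fun _ w => s w) k, ⟨rfl, fun k => hs _⟩, ?_⟩
  rintro ω ⟨h0, hk⟩
  funext k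
  induction k with
  | zero => exact h0
  | succ k ih =>
    have h := hsu _ _ (hk k)
    rw [h, ih]

end AggGame

/-! ### Fejér monotone sequences. -/

/-- The form attains a positive minimum on the unit sphere. This compares the preconditioner with
the product norm of `Core`, which is not Euclidean. -/
theorem exists_coercivity_const {E : Type*} [NormedAddCommGroup E] [NormedSpace ℝ E]
    [ProperSpace E] {q : E → ℝ} (hqc : Continuous q)
    (hhom : ∀ (t : ℝ) (v : E), q (t • v) = t ^ 2 * q v) (hpos : ∀ v, v ≠ 0 → 0 < q v) :
    ∃ c : ℝ, 0 < c ∧ ∀ v, c * ‖v‖ ^ 2 ≤ q v := by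
  have h0 : q 0 = 0 := by simpa using hhom 0 0
  rcases (Metric.sphere (0 : E) 1).eq_empty_or_nonempty with he | hne
  · refine ⟨1, one_pos, fun v => ?_⟩
    by_cases hv : v = 0
    · simp [hv, h0]
    · have : ‖v‖⁻¹ • v ∈ Metric.sphere (0 : E) 1 := by
        simp [norm_smul, hv]
      rw [he] at this
      exact this.elim
  · obtain ⟨x, hx, hmin⟩ := (isCompact_sphere (0 : E) 1).exists_isMinOn hne hqc.continuousOn
    have hx0 : x ≠ 0 := by
      rintro rfl
      simp at hx
    refine ⟨q x, hpos x hx0, fun v => ?_⟩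
    by_cases hv : v = 0
    · simp [hv, h0]
    · have hn : ‖v‖ ≠ 0 := norm_ne_zero_iff.2 hv
      have h1 : q x ≤ q (‖v‖⁻¹ • v) := hmin (by simp [norm_smul, hv])
      rw [hhom] at h1
      have h2 : q v = ‖v‖ ^ 2 * (‖v‖⁻¹ ^ 2 * q v) := by
        field_simp
      rw [h2, mul_comm]
      exact mul_le_mul_of_nonneg_left h1 (by positivity)

/-- Convergence of a sequence that is Fejér monotone with respect to a coercive form. -/
theorem exists_tendsto_of_fejer {E : Type*} [NormedAddCommGroup E] [ProperSpace E] {q : E → ℝ}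
    (hqc : Continuous q) (hq0 : q 0 = 0) {c : ℝ}
    (hc : 0 < c) (hcoer : ∀ v, c * ‖v‖ ^ 2 ≤ q v) {Z : Set E} (hZ : Z.Nonempty) {u : ℕ → E}
    (hdec : ∀ z ∈ Z, ∀ k, q (u (k + 1) - z) + q (u (k + 1) - u k) ≤ q (u k - z))
    (hcl : ∀ s : ℕ → ℕ, ∀ w, Tendsto (fun k => u (s k)) atTop (𝓝 w) →
      Tendsto (fun k => u (s k + 1)) atTop (𝓝 w) → w ∈ Z) :
    ∃ w ∈ Z, Tendsto u atTop (𝓝 w) := by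
  have hnn : ∀ v, 0 ≤ q v := fun v => (by positivity : 0 ≤ c * ‖v‖ ^ 2).trans (hcoer v)
  have hto0 : ∀ v : ℕ → E, Tendsto (fun k => q (v k)) atTop (𝓝 0) → Tendsto v atTop (𝓝 0) := by
    intro v hv
    have h1 : Tendsto (fun k => ‖v k‖ ^ 2) atTop (𝓝 0) := by
      refine squeeze_zero (fun k => by positivity) (fun k => ?_)
        (by simpa using hv.const_mul c⁻¹)
      rw [← div_eq_inv_mul, le_div_iff₀ hc, mul_comm]
      exact hcoer _
    have h2 := h1.sqrt
    simp only [Real.sqrt_zero] at h2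
    exact tendsto_zero_iff_norm_tendsto_zero.2 (h2.congr fun k => Real.sqrt_sq (norm_nonneg _))
  have hanti : ∀ z ∈ Z, Antitone fun k => q (u k - z) := fun z hz =>
    antitone_nat_of_succ_le fun k => by linarith [hdec z hz k, hnn (u (k + 1) - u k)]
  have hconv : ∀ z ∈ Z, ∃ l, Tendsto (fun k => q (u k - z)) atTop (𝓝 l) := fun z hz =>
    ⟨_, tendsto_atTop_ciInf (hanti z hz) ⟨0, by rintro _ ⟨k, rfl⟩; exact hnn _⟩⟩
  obtain ⟨z, hz⟩ := hZ
  obtain ⟨l, hl⟩ := hconv z hz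
  have hΔ : Tendsto (fun k => u (k + 1) - u k) atTop (𝓝 0) := by
    refine hto0 _ (squeeze_zero (fun k => hnn _) (fun k => ?_)
      (by simpa using hl.sub (hl.comp (tendsto_add_atTop_nat 1))))
    have := hdec z hz k
    linarith
  have hbdd : ∀ k, u k ∈ Metric.closedBall z (Real.sqrt (q (u 0 - z) / c)) := by
    intro k
    rw [mem_closedBall_iff_norm]
    apply Real.le_sqrt_of_sq_le
    rw [le_div_iff₀ hc, mul_comm]
    exact (hcoer _).trans (hanti z hz (Nat.zero_le k))
  obtain ⟨w, -, s, hs, hsw⟩ := tendsto_subseq_of_bounded Metric.isBounded_closedBall hbdd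
  have hsw1 : Tendsto (fun k => u (s k + 1)) atTop (𝓝 w) := by
    have := (hΔ.comp hs.tendsto_atTop).add hsw
    simpa using this
  have hw : w ∈ Z := hcl s w hsw hsw1
  refine ⟨w, hw, ?_⟩
  -- The cluster point lies in Z, so the distances to it converge; their limit is zero along the
  -- subsequence, hence along the whole sequence.
  obtain ⟨l', hl'⟩ := hconv w hw
  have h1 : Tendsto (fun k => q (u (s k) - w)) atTop (𝓝 (q (w - w))) :=
    (hqc.tendsto _).comp (Tendsto.sub_const hsw w)
  rw [sub_self, hq0] at h1
  have h2 : l' = 0 := tendsto_nhds_unique (hl'.comp hs.tendsto_atTop) h1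
  have h3 := (hto0 _ (h2 ▸ hl')).add_const w
  simpa using h3

/-! ### The preconditioner. -/

/-- The variables `(x, σ, μ, λ)`, from which `y` is recovered. -/
abbrev Core (N n m : ℕ) := Prof N n × Vec n × Vec n × Vec m

namespace State

/-- Projection of a state on the variables `(x, σ, μ, λ)`. -/
def core {N n m : ℕ} (w : State N n m) : Core N n m := (w.x, w.σ, w.μ, w.lam)

end State

namespace StepSizes

variable {N : ℕ} (p : StepSizes N)

theorem sum_γ_pos (hN : 0 < N) : 0 < ∑ i, p.γ i :=
  Finset.sum_pos (fun i _ => p.γ_pos i) ⟨⟨0, hN⟩, Finset.mem_univ _⟩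

/-- Makes the coefficient of ‖λ‖² in `precForm_self` positive. -/
theorem sum_γ_lt (hN : 0 < N) : ∑ i, p.γ i < N / p.δc := by
  have hN' : (0 : ℝ) < N := by exact_mod_cast hN
  have h := p.δc_mem.2
  have hs := p.sum_γ_pos hN
  have hm : 0 < meanStep p.γ := mul_pos (by positivity) hs
  rw [lt_div_iff₀ hm] at h
  rw [lt_div_iff₀ p.δc_mem.1]
  have h2 : p.δc * meanStep p.γ * N = (∑ i, p.γ i) * p.δc := by
    unfold meanStep; field_simp
  nlinarith

/-- Makes the coefficient of ‖μ‖² in `precForm_self` positive. -/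
theorem sum_γ_div_lt (hN : 0 < N) : (∑ i, p.γ i) / N ^ 2 < 1 / p.βc - p.α := by
  have hN' : (0 : ℝ) < N := by exact_mod_cast hN
  have h := p.βc_mem.2
  have hs := p.sum_γ_pos hN
  have hm : 0 < p.α + meanStep p.γ / N :=
    add_pos p.α_pos (div_pos (mul_pos (by positivity) hs) hN')
  have h2 : meanStep p.γ / N = (∑ i, p.γ i) / N ^ 2 := by
    unfold meanStep; field_simp
  rw [← h2]
  have := (lt_one_div p.βc_mem.1 hm).1 h
  linarith

end StepSizes

namespace AggGame

variable {N n m : ℕ} (G : AggGame N n m) (p : StepSizes N)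

/-- Symmetric bilinear form of the preconditioner, for which the algorithm is a proximal-point
iteration. -/
def precForm (v w : Core N n m) : ℝ :=
  ∑ i, (1 / p.γ i * (inner ℝ (v.1 i) (w.1 i) + inner ℝ (mulV (G.A i) (v.1 i)) (mulV (G.A i) (w.1 i)))
    + 1 / (N : ℝ) * (inner ℝ (v.1 i) w.2.2.1 + inner ℝ v.2.2.1 (w.1 i))
    - inner ℝ (mulV (G.A i) (v.1 i)) w.2.2.2 - inner ℝ v.2.2.2 (mulV (G.A i) (w.1 i)))
  + 1 / p.α * inner ℝ v.2.1 w.2.1 + (1 / p.βc - p.α) * inner ℝ v.2.2.1 w.2.2.1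
  + N / p.δc * inner ℝ v.2.2.2 w.2.2.2

theorem precForm_comm (v w : Core N n m) : G.precForm p v w = G.precForm p w v := by
  unfold precForm
  rw [real_inner_comm w.2.1, real_inner_comm w.2.2.1 v.2.2.1, real_inner_comm w.2.2.2 v.2.2.2]
  congr 3
  refine Finset.sum_congr rfl fun i _ => ?_
  rw [real_inner_comm (w.1 i) (v.1 i), real_inner_comm (mulV (G.A i) (w.1 i)) (mulV (G.A i) (v.1 i)),
    real_inner_comm w.2.2.1 (v.1 i), real_inner_comm (w.1 i) v.2.2.1,
    real_inner_comm w.2.2.2 (mulV (G.A i) (v.1 i)), real_inner_comm (mulV (G.A i) (w.1 i)) v.2.2.2]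
  ring

theorem precForm_sub_left (v v' w : Core N n m) :
    G.precForm p (v - v') w = G.precForm p v w - G.precForm p v' w := by
  unfold precForm
  simp only [Prod.fst_sub, Prod.snd_sub, PiLp.sub_apply, mulV_sub, inner_sub_left]
  rw [show ∀ a b c d a' b' c' d' : ℝ, a + b + c + d - (a' + b' + c' + d')
    = (a - a') + (b - b') + (c - c') + (d - d') by intros; ring, ← Finset.sum_sub_distrib]
  congr 1
  · congr 1
    · congr 1
      · exact Finset.sum_congr rfl fun i _ => by ring
      · ring
    · ring
  · ring

theorem precForm_sub_right (v w w' : Core N n m) :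
    G.precForm p v (w - w') = G.precForm p v w - G.precForm p v w' := by
  rw [precForm_comm, precForm_sub_left, precForm_comm _ _ w, precForm_comm _ _ w']

theorem precForm_smul_smul (t : ℝ) (v : Core N n m) :
    G.precForm p (t • v) (t • v) = t ^ 2 * G.precForm p v v := by
  unfold precForm
  simp only [Prod.smul_fst, Prod.smul_snd, PiLp.smul_apply, mulV_smul, real_inner_smul_left,
    real_inner_smul_right, mul_add, Finset.mul_sum]
  congr 1
  · congr 1
    · congr 1
      · exact Finset.sum_congr rfl fun i _ => by ring
      · ring
    · ring
  · ring

theorem continuous_precForm_self : Continuous fun v : Core N n m => G.precForm p v v := by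
  unfold precForm
  have := fun i => continuous_mulV (G.A i)
  fun_prop

/-- The preconditioner as a sum of squares. -/
theorem precForm_self (v : Core N n m) : G.precForm p v v =
    ∑ i, 1 / p.γ i * (‖v.1 i + (p.γ i / N) • v.2.2.1‖ ^ 2
      + ‖mulV (G.A i) (v.1 i) - p.γ i • v.2.2.2‖ ^ 2)
    + 1 / p.α * ‖v.2.1‖ ^ 2 + (1 / p.βc - p.α - (∑ i, p.γ i) / N ^ 2) * ‖v.2.2.1‖ ^ 2
    + (N / p.δc - ∑ i, p.γ i) * ‖v.2.2.2‖ ^ 2 := by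
  have h : ∀ i, 1 / p.γ i * (‖v.1 i + (p.γ i / N) • v.2.2.1‖ ^ 2
      + ‖mulV (G.A i) (v.1 i) - p.γ i • v.2.2.2‖ ^ 2)
      = (1 / p.γ i * (inner ℝ (v.1 i) (v.1 i)
          + inner ℝ (mulV (G.A i) (v.1 i)) (mulV (G.A i) (v.1 i)))
        + 1 / (N : ℝ) * (inner ℝ (v.1 i) v.2.2.1 + inner ℝ v.2.2.1 (v.1 i))
        - inner ℝ (mulV (G.A i) (v.1 i)) v.2.2.2 - inner ℝ v.2.2.2 (mulV (G.A i) (v.1 i)))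
        + p.γ i * (1 / N ^ 2 * ‖v.2.2.1‖ ^ 2 + ‖v.2.2.2‖ ^ 2) := by
    intro i
    have hγ := (p.γ_pos i).ne'
    have hN : (N : ℝ) ≠ 0 := Nat.cast_ne_zero.2 i.pos.ne'
    simp only [← real_inner_self_eq_norm_sq, inner_add_left, inner_add_right, inner_sub_left,
      inner_sub_right, real_inner_smul_left, real_inner_smul_right]
    rw [real_inner_comm (v.1 i) v.2.2.1, real_inner_comm (mulV (G.A i) (v.1 i)) v.2.2.2]
    field_simp
    ring
  rw [Finset.sum_congr rfl fun i _ => h i, Finset.sum_add_distrib, ← Finset.sum_mul]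
  unfold precForm
  simp only [real_inner_self_eq_norm_sq]
  ring

theorem precForm_self_pos (hN : 0 < N) {v : Core N n m} (hv : v ≠ 0) : 0 < G.precForm p v v := by
  have hb := sub_pos.2 (p.sum_γ_div_lt hN)
  have hd := sub_pos.2 (p.sum_γ_lt hN)
  have ha := one_div_pos.2 p.α_pos
  have hs : ∀ i, 0 ≤ 1 / p.γ i * (‖v.1 i + (p.γ i / N) • v.2.2.1‖ ^ 2
      + ‖mulV (G.A i) (v.1 i) - p.γ i • v.2.2.2‖ ^ 2) := fun i => by
    have := p.γ_pos i
    positivity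
  have hS := Finset.sum_nonneg fun i (_ : i ∈ Finset.univ) => hs i
  have h1 := mul_nonneg ha.le (sq_nonneg ‖v.2.1‖)
  have h2 := mul_nonneg hb.le (sq_nonneg ‖v.2.2.1‖)
  have h3 := mul_nonneg hd.le (sq_nonneg ‖v.2.2.2‖)
  by_contra hle
  rw [precForm_self] at hle
  have e1 : v.2.1 = 0 := by
    have : 1 / p.α * ‖v.2.1‖ ^ 2 = 0 := by linarith
    simpa [ha.ne', p.α_pos.ne'] using this
  have e2 : v.2.2.1 = 0 := by
    have : (1 / p.βc - p.α - (∑ i, p.γ i) / N ^ 2) * ‖v.2.2.1‖ ^ 2 = 0 := by linarith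
    rcases mul_eq_zero.1 this with h | h
    · exact absurd h hb.ne'
    · simpa using h
  have e3 : v.2.2.2 = 0 := by
    have : (N / p.δc - ∑ i, p.γ i) * ‖v.2.2.2‖ ^ 2 = 0 := by linarith
    rcases mul_eq_zero.1 this with h | h
    · exact absurd h hd.ne'
    · simpa using h
  have e0 : v.1 = 0 := by
    ext i : 1
    have h4 := (Finset.sum_eq_zero_iff_of_nonneg fun i _ => hs i).1
      (le_antisymm (by linarith) hS) i (Finset.mem_univ i)
    rcases mul_eq_zero.1 h4 with h | h
    · exact absurd h (one_div_pos.2 (p.γ_pos i)).ne'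
    · rw [e2, smul_zero, add_zero] at h
      have h5 : ‖v.1 i‖ ^ 2 = 0 := by
        have := sq_nonneg ‖v.1 i‖
        have := sq_nonneg ‖mulV (G.A i) (v.1 i) - p.γ i • v.2.2.2‖
        linarith
      simpa using h5
  exact hv (Prod.ext e0 (Prod.ext e1 (Prod.ext e2 e3)))

theorem precForm_three_point {u v z : Core N n m} (h : G.precForm p (v - u) (v - z) ≤ 0) :
    G.precForm p (v - z) (v - z) + G.precForm p (v - u) (v - u)
      ≤ G.precForm p (u - z) (u - z) := by
  have e : u - z = (v - z) - (v - u) := by abel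
  have h1 : G.precForm p (u - z) (u - z) = G.precForm p (v - z) (v - z)
      - 2 * G.precForm p (v - u) (v - z) + G.precForm p (v - u) (v - u) := by
    rw [e, precForm_sub_left G p (v - z) (v - u), precForm_sub_right G p (v - z) (v - z) (v - u),
      precForm_sub_right G p (v - u) (v - z) (v - u), precForm_comm G p (v - z) (v - u)]
    ring
  linarith

/-! ### KKT points and the decrease of one step. -/

/-- Primal-dual optimality of `(x, σ, μ, λ)` for the costs `φ`. -/
structure IsKKT (φ : Fin N → Vec n → ℝ) (z : Core N n m) : Prop where
  x_mem : ∀ i, z.1 i ∈ G.Ω i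
  opt : ∀ i, ∀ x ∈ G.Ω i, φ i (z.1 i) ≤ φ i x + inner ℝ z.2.2.2 (mulV (G.A i) (x - z.1 i))
  σ_eq : z.2.1 = avg z.1
  μ_eq : z.2.2.1 = 0
  lam_mem : z.2.2.2 ∈ nonnegOrthant m
  compl : ∀ l ∈ nonnegOrthant m, inner ℝ (G.coupling z.1) (l - z.2.2.2) ≤ 0

theorem coupling_sub (x x' : Prof N n) :
    G.coupling x - G.coupling x' = ∑ i, mulV (G.A i) (x i - x' i) := by
  simp only [coupling, mulV_sub, Finset.sum_sub_distrib]
  abel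

theorem avg_eq_coupling {x : Prof N n} {y : Prof N m} (h : ∀ i, y i = mulV (G.A i) (x i) - G.b i) :
    avg y = (1 / (N : ℝ)) • G.coupling x := by
  simp only [avg, coupling, h, Finset.sum_sub_distrib]

variable {G p}

theorem IsStep.inner_lam_le {w w' : State N n m} (hs : G.IsStep p w w')
    (hy : ∀ i, w.y i = mulV (G.A i) (w.x i) - G.b i) {l : Vec m} (hl : l ∈ nonnegOrthant m) :
    inner ℝ (w.lam + (p.δc / N) • ((2 : ℝ) • G.coupling w'.x - G.coupling w.x) - w'.lam)
      (l - w'.lam) ≤ 0 := by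
  have h := ((mem_projOn_iff (convex_nonnegOrthant m)).1 hs.lam_mem).2 l hl
  rw [G.avg_eq_coupling hs.y_eq, G.avg_eq_coupling hy] at h
  convert h using 3
  rw [div_eq_mul_one_div]
  module

theorem avg_sub (x x' : Prof N n) : avg (x - x') = avg x - avg x' := by
  simp [avg, Finset.sum_sub_distrib, smul_sub]

theorem inner_avg_left (x : Prof N n) (v : Vec n) :
    inner ℝ (avg x) v = ∑ i, 1 / (N : ℝ) * inner ℝ (x i) v := by
  rw [avg, real_inner_smul_left, sum_inner, Finset.mul_sum]

/-- Monotonicity of the KKT system, tested between the new iterate and a KKT point. The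
extrapolations 2x' - x and 2y' - y produce exactly the off-diagonal terms of `precForm`. -/
theorem IsPotential.precForm_step_le {φ : Fin N → Vec n → ℝ} (hφ : G.IsPotential φ) (hN : 0 < N)
    {w w' : State N n m} (hs : G.IsStep p w w')
    (hy : ∀ i, w.y i = mulV (G.A i) (w.x i) - G.b i) {z : Core N n m} (hz : G.IsKKT φ z) :
    G.precForm p (w'.core - w.core) (w'.core - z) ≤ 0 := by
  have hN' : (0 : ℝ) < N := by exact_mod_cast hN
  obtain ⟨zx, zs, zμ, zl⟩ := z
  obtain ⟨hzx, hzo, hzs, hzμ, hzl, hzc⟩ := hz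
  simp only at hzx hzo hzs hzμ hzl hzc
  subst hzs hzμ
  have hδ := p.δc_mem.1
  -- Add the optimality of x' tested at z to that of z tested at x'; the values of φ cancel.
  have hx : ∀ i, 1 / p.γ i * (inner ℝ (w'.x i - w.x i) (w'.x i - zx i)
      + inner ℝ (mulV (G.A i) (w'.x i - w.x i)) (mulV (G.A i) (w'.x i - zx i)))
      ≤ inner ℝ (zl - w.lam) (mulV (G.A i) (w'.x i - zx i))
        + 1 / (N : ℝ) * inner ℝ w.μ (w'.x i - zx i) := by
    intro i
    have h1 := hφ.variational_of_argmin (hs.x_mem i) (hzx i)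
    have h2 := hzo i _ (hs.x_mem i).1
    have e1 : zx i - w'.x i = -(w'.x i - zx i) := by abel
    have e2 : mulV (G.A i) (-(w'.x i - zx i)) = -mulV (G.A i) (w'.x i - zx i) := map_neg _ _
    rw [e1, e2] at h1
    simp only [inner_neg_right] at h1
    rw [inner_sub_left zl w.lam]
    linarith
  -- Projection inequality tested at the multiplier of z, combined with the complementarity of z.
  have hlam : N / p.δc * inner ℝ (w'.lam - w.lam) (w'.lam - zl)
      ≤ ∑ i, (inner ℝ (mulV (G.A i) (w'.x i - w.x i)) (w'.lam - zl)
        + inner ℝ (w'.lam - zl) (mulV (G.A i) (w'.x i - zx i))) := by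
    have h1 := hs.inner_lam_le hy hzl
    have h2 := hzc _ ((mem_projOn_iff (convex_nonnegOrthant m)).1 hs.lam_mem).1
    have e1 : zl - w'.lam = -(w'.lam - zl) := by abel
    have e2 : w.lam + (p.δc / N) • ((2 : ℝ) • G.coupling w'.x - G.coupling w.x) - w'.lam
        = (p.δc / N) • ((G.coupling w'.x - G.coupling w.x) + (G.coupling w'.x - G.coupling zx)
          + G.coupling zx) - (w'.lam - w.lam) := by module
    rw [e1, e2, inner_neg_right, inner_sub_left, real_inner_smul_left, inner_add_left,
      inner_add_left, coupling_sub, coupling_sub, sum_inner, sum_inner] at h1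
    rw [Finset.sum_add_distrib, Finset.sum_congr rfl fun i _ =>
      real_inner_comm (mulV (G.A i) (w'.x i - zx i)) (w'.lam - zl)]
    rw [div_mul_eq_mul_div, div_le_iff₀ hδ]
    have h3 : inner ℝ (w'.lam - w.lam) (w'.lam - zl) ≤ p.δc / N *
        (∑ i, inner ℝ (mulV (G.A i) (w'.x i - w.x i)) (w'.lam - zl)
          + ∑ i, inner ℝ (mulV (G.A i) (w'.x i - zx i)) (w'.lam - zl)) := by
      have h4 : p.δc / N * inner ℝ (G.coupling zx) (w'.lam - zl) ≤ 0 :=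
        mul_nonpos_of_nonneg_of_nonpos (by positivity) h2
      linarith
    rw [div_mul_eq_mul_div, le_div_iff₀ hN'] at h3
    linarith
  have hσ : 1 / p.α * inner ℝ (w'.σ - w.σ) (w'.σ - avg zx) = -inner ℝ w'.μ (w'.σ - avg zx) := by
    have e : w'.σ - w.σ = -(p.α • w'.μ) := by rw [hs.σ_eq]; abel
    have := p.α_pos.ne'
    rw [e, inner_neg_left, real_inner_smul_left]
    field_simp
  have hμ : (1 / p.βc - p.α) * inner ℝ (w'.μ - w.μ) w'.μ = inner ℝ (w'.σ - avg zx) w'.μ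
      - ∑ i, (1 / (N : ℝ) * inner ℝ (w'.x i - w.x i) w'.μ
        + 1 / (N : ℝ) * inner ℝ (w'.x i - zx i) w'.μ) := by
    have hβ := p.βc_mem.1.ne'
    -- Substituting σ = σ' + αμ' cancels every μ on the right; this is why the μ block carries 1/β -
    -- α.
    have e : (1 / p.βc - p.α) • (w'.μ - w.μ)
        = (w'.σ - avg zx) - avg (w'.x - w.x) - avg (w'.x - zx) := by
      have e1 : w'.μ - w.μ = -(p.βc • ((2 : ℝ) • avg w'.x - avg w.x - w.σ + p.α • w.μ)) := by
        rw [hs.μ_eq]; abel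
      have e2 : (1 / p.βc) • (w'.μ - w.μ)
          = -((2 : ℝ) • avg w'.x - avg w.x - w.σ + p.α • w.μ) := by
        rw [e1, smul_neg, smul_smul, one_div, inv_mul_cancel₀ hβ, one_smul]
      rw [sub_smul, e2, hs.σ_eq, avg_sub, avg_sub]
      module
    rw [← real_inner_smul_left, e, inner_sub_left, inner_sub_left, inner_avg_left, inner_avg_left,
      Finset.sum_add_distrib]
    simp only [PiLp.sub_apply]
    ring
  have hsum : ∑ i, (1 / p.γ i * (inner ℝ (w'.x i - w.x i) (w'.x i - zx i)
        + inner ℝ (mulV (G.A i) (w'.x i - w.x i)) (mulV (G.A i) (w'.x i - zx i)))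
      + 1 / (N : ℝ) * (inner ℝ (w'.x i - w.x i) w'.μ + inner ℝ (w'.μ - w.μ) (w'.x i - zx i))
      - inner ℝ (mulV (G.A i) (w'.x i - w.x i)) (w'.lam - zl)
      - inner ℝ (w'.lam - w.lam) (mulV (G.A i) (w'.x i - zx i)))
      ≤ ∑ i, (1 / (N : ℝ) * inner ℝ (w'.x i - w.x i) w'.μ
        + 1 / (N : ℝ) * inner ℝ (w'.x i - zx i) w'.μ)
      - ∑ i, (inner ℝ (mulV (G.A i) (w'.x i - w.x i)) (w'.lam - zl)
        + inner ℝ (w'.lam - zl) (mulV (G.A i) (w'.x i - zx i))) := by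
    rw [← Finset.sum_sub_distrib]
    refine Finset.sum_le_sum fun i _ => ?_
    have h := hx i
    rw [real_inner_comm w'.μ (w'.x i - zx i)]
    simp only [inner_sub_left (w'.lam) _ (mulV (G.A i) (w'.x i - zx i)), inner_sub_left w'.μ w.μ,
      inner_sub_left zl w.lam] at h ⊢
    linarith
  unfold precForm
  simp only [State.core, Prod.fst_sub, Prod.snd_sub, PiLp.sub_apply, sub_zero]
  rw [hσ, hμ, real_inner_comm w'.μ (w'.σ - avg zx)]
  linarith

end AggGame

/-! ### Existence of KKT points. -/

namespace AggGame

variable {N n m : ℕ} {G : AggGame N n m} {φ : Fin N → Vec n → ℝ}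

theorem continuous_coupling (G : AggGame N n m) : Continuous G.coupling := by
  unfold coupling
  have := fun i => continuous_mulV (G.A i)
  fun_prop

theorem continuous_avg : Continuous (avg : Prof N n → Vec n) := by
  unfold avg
  fun_prop

theorem respectsAffine_coupling (G : AggGame N n m) (j : Fin m) :
    RespectsAffine fun x => G.coupling x j := by
  intro x y a b hab
  have h : G.coupling (a • x + b • y) = a • G.coupling x + b • G.coupling y := by
    obtain rfl : b = 1 - a := by linarith
    simp only [coupling, PiLp.add_apply, PiLp.smul_apply, mulV_add, mulV_smul,
      Finset.sum_add_distrib, ← Finset.smul_sum]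
    module
  change G.coupling (a • x + b • y) j = a * G.coupling x j + b * G.coupling y j
  rw [h]
  simp

theorem convex_localSets (hΩ : G.CompactConvexSlater) :
    Convex ℝ {x : Prof N n | ∀ i, x i ∈ G.Ω i} :=
  fun _ hx _ hy _ _ ha hb hab i => hΩ.convex i (hx i) (hy i) ha hb hab

theorem isCompact_localSets (hΩ : G.CompactConvexSlater) :
    IsCompact {x : Prof N n | ∀ i, x i ∈ G.Ω i} := by
  have h := (isCompact_univ_pi hΩ.compact).image (PiLp.continuous_toLp 2 fun _ : Fin N => Vec n)
  convert h using 1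
  ext x
  constructor
  · exact fun hx => ⟨x, fun i _ => hx i, rfl⟩
  · rintro ⟨y, hy, rfl⟩ i
    exact hy i (mem_univ i)

theorem isCompact_X (hΩ : G.CompactConvexSlater) : IsCompact G.X := by
  have h : G.X = {x : Prof N n | ∀ i, x i ∈ G.Ω i} ∩ ⋂ j, {x | G.coupling x j ≤ 0} := by
    ext x
    simp [X]
  rw [h]
  refine (isCompact_localSets hΩ).inter_right (isClosed_iInter fun j => isClosed_le ?_
    continuous_const)
  have := G.continuous_coupling
  fun_prop

theorem IsPotential.convexOn_sum (hφ : G.IsPotential φ) (hΩ : G.CompactConvexSlater) :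
    ConvexOn ℝ {x : Prof N n | ∀ i, x i ∈ G.Ω i} fun x => ∑ i, φ i (x i) := by
  refine ⟨convex_localSets hΩ, fun x hx y hy a b ha hb hab => ?_⟩
  simp only [smul_eq_mul, Finset.mul_sum]
  rw [← Finset.sum_add_distrib]
  exact Finset.sum_le_sum fun i _ => (hφ.convexOn i).2 (hx i) (hy i) ha hb hab

/-- There are finitely many agents, so one small prolongation length serves all of them. -/
theorem prolongableAt_localSets {x₀ : Prof N n}
    (h₀ : ∀ i, x₀ i ∈ intrinsicInterior ℝ (G.Ω i)) :
    ProlongableAt {x : Prof N n | ∀ i, x i ∈ G.Ω i} x₀ := by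
  refine ⟨fun i => intrinsicInterior_subset (h₀ i), fun x hx => ?_⟩
  have h : ∀ᶠ t : ℝ in 𝓝 0, ∀ i, (1 + t) • x₀ i + (-t) • x i ∈ G.Ω i :=
    eventually_all.2 fun i => eventually_prolong_mem (h₀ i) (hx i)
  obtain ⟨t, ht, ht0⟩ := ((h.filter_mono nhdsWithin_le_nhds).and
    (self_mem_nhdsWithin : Ioi (0 : ℝ) ∈ 𝓝[>] 0)).exists
  exact ⟨t, ht0, ht⟩

theorem inner_eq_sum_mul (v w : Vec m) : inner ℝ v w = ∑ j, v j * w j := by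
  rw [PiLp.inner_apply]
  exact Finset.sum_congr rfl fun j _ => by simp [mul_comm]

/-- Under Slater's condition the convex program of the game has a primal-dual solution. -/
theorem IsPotential.exists_isKKT (hφ : G.IsPotential φ) (hΩ : G.CompactConvexSlater) :
    ∃ z, G.IsKKT φ z := by
  obtain ⟨x₀, hx₀, hc₀⟩ := hΩ.slater
  have hne : G.X.Nonempty := ⟨x₀, fun i => intrinsicInterior_subset (hx₀ i), hc₀⟩
  have hcont : ContinuousOn (fun x : Prof N n => ∑ i, φ i (x i)) G.X :=
    continuousOn_finsetSum _ fun i _ => (hφ.continuousOn i).comp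
      (by fun_prop : Continuous fun x : Prof N n => x i).continuousOn fun x hx => hx.1 i
  obtain ⟨x, hx, hmin⟩ := (isCompact_X hΩ).exists_isMinOn hne hcont
  obtain ⟨c, hc, hcx⟩ := exists_multipliers (G.respectsAffine_coupling) Finset.univ
    {x : Prof N n | ∀ i, x i ∈ G.Ω i} (fun y => ∑ i, φ i (y i) - ∑ i, φ i (x i))
    ((hφ.convexOn_sum hΩ).sub (concaveOn_const _ (convex_localSets hΩ)))
    (prolongableAt_localSets hx₀) (fun j _ => hc₀ j)
    (fun y hy hyc => sub_nonneg.2 (hmin ⟨hy, fun j => hyc j (Finset.mem_univ j)⟩))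
  let l : Vec m := WithLp.toLp 2 c
  have hl : ∀ y, ∑ j, c j * G.coupling y j = inner ℝ l (G.coupling y) := fun y =>
    (inner_eq_sum_mul l _).symm
  simp only [hl] at hcx
  have hle : ∀ v ∈ nonnegOrthant m, inner ℝ (G.coupling x) v ≤ 0 := by
    intro v hv
    rw [inner_eq_sum_mul]
    exact Finset.sum_nonpos fun j _ => mul_nonpos_of_nonpos_of_nonneg (hx.2 j) (hv j)
  -- Complementary slackness: evaluate the Lagrangian inequality at the minimizer itself.
  have hcs : inner ℝ (G.coupling x) l = 0 := by
    refine le_antisymm (hle l hc) ?_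
    simpa [real_inner_comm] using hcx x hx.1
  refine ⟨(x, avg x, 0, l), hx.1, fun i z hz => ?_, rfl, rfl, hc, fun v hv => ?_⟩
  -- Moving a single block turns the joint Lagrangian inequality into that of agent i.
  · let x' : Prof N n := WithLp.toLp 2 (Function.update x i z)
    have hx'i : x' i = z := by simp [x']
    have hx'k : ∀ k, k ≠ i → x' k = x k := fun k hk => by simp [x', hk]
    have h1 := hcx x' (fun k => by
      by_cases hk : k = i
      · subst hk; rwa [hx'i]
      · rw [hx'k k hk]; exact hx.1 k)
    have h2 : ∑ k, φ k (x' k) - ∑ k, φ k (x k) = φ i z - φ i (x i) := by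
      rw [← Finset.sum_sub_distrib, Finset.sum_eq_single i (fun k _ hk => by
        rw [hx'k k hk, sub_self]) (by simp), hx'i]
    have h3 : G.coupling x' = G.coupling x + mulV (G.A i) (z - x i) := by
      rw [← sub_eq_iff_eq_add', coupling_sub, Finset.sum_eq_single i (fun k _ hk => by
        rw [hx'k k hk, sub_self, mulV_zero]) (by simp), hx'i]
    rw [h2, h3, inner_add_right, real_inner_comm, hcs] at h1
    simp only
    linarith
  · simp only [inner_sub_right, hcs, sub_zero]
    exact hle v hv

/-! ### Convergence of the iteration. -/

/-- Both ends of the step tend to z, so z satisfies the fixed-point relations: the σ update yields μ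
= 0, and then the μ update yields σ = avg x. The inequalities for x and λ pass to the limit. -/
theorem IsPotential.isKKT_of_tendsto (hφ : G.IsPotential φ) (hΩ : G.CompactConvexSlater)
    (hN : 0 < N) {p : StepSizes N} {w w' : ℕ → State N n m} (hs : ∀ k, G.IsStep p (w k) (w' k))
    (hy : ∀ k i, (w k).y i = mulV (G.A i) ((w k).x i) - G.b i) {z : Core N n m}
    (hw : Tendsto (fun k => (w k).core) atTop (𝓝 z))
    (hw' : Tendsto (fun k => (w' k).core) atTop (𝓝 z)) : G.IsKKT φ z := by
  have hN' : (0 : ℝ) < N := by exact_mod_cast hN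
  have hpair : Tendsto (fun k => ((w k).core, (w' k).core)) atTop (𝓝 (z, z)) :=
    hw.prodMk_nhds hw'
  have hA := fun i => continuous_mulV (G.A i)
  have havg := continuous_avg (N := N) (n := n)
  have hcoup := G.continuous_coupling
  have hxi : ∀ i, Tendsto (fun k => (w' k).x i) atTop (𝓝 (z.1 i)) := fun i =>
    ((by fun_prop : Continuous fun u : Core N n m => u.1 i).tendsto z).comp hw'
  have hmem : ∀ i, z.1 i ∈ G.Ω i := fun i =>
    (hΩ.compact i).isClosed.mem_of_tendsto (hxi i) (Eventually.of_forall fun k =>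
      ((hs k).x_mem i).1)
  have hμ : z.2.2.1 = 0 := by
    have h : z.2.1 = z.2.1 - p.α • z.2.2.1 := by
      refine tendsto_nhds_unique (((by fun_prop : Continuous fun u : Core N n m × Core N n m =>
        u.2.2.1).tendsto _).comp hpair) ((((by fun_prop : Continuous fun u : Core N n m ×
        Core N n m => u.1.2.1 - p.α • u.2.2.2.1).tendsto _).comp hpair).congr fun k => ?_)
      exact (hs k).σ_eq.symm
    rwa [eq_comm, sub_eq_self, smul_eq_zero, or_iff_right p.α_pos.ne'] at h
  have hσ : z.2.1 = avg z.1 := by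
    have h : z.2.2.1 = z.2.2.1
        - p.βc • ((2 : ℝ) • avg z.1 - avg z.1 - z.2.1 + p.α • z.2.2.1) := by
      refine tendsto_nhds_unique (((by fun_prop : Continuous fun u : Core N n m × Core N n m =>
        u.2.2.2.1).tendsto _).comp hpair) ((((by fun_prop : Continuous fun u : Core N n m ×
        Core N n m => u.1.2.2.1 - p.βc • ((2 : ℝ) • avg u.2.1 - avg u.1.1 - u.1.2.1
          + p.α • u.1.2.2.1)).tendsto _).comp hpair).congr fun k => ?_)
      exact (hs k).μ_eq.symm
    rw [hμ, smul_zero, add_zero, eq_comm, sub_eq_self, smul_eq_zero,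
      or_iff_right p.βc_mem.1.ne', two_smul, add_sub_cancel_right, sub_eq_zero] at h
    exact h.symm
  have hlam' : ∀ k, (w' k).lam ∈ nonnegOrthant m := fun k =>
    ((mem_projOn_iff (convex_nonnegOrthant m)).1 (hs k).lam_mem).1
  refine ⟨hmem, fun i x hx => ?_, hσ, hμ, ?_, fun l hl => ?_⟩
  · have h1 : Tendsto (fun k => φ i ((w' k).x i)) atTop (𝓝 (φ i (z.1 i))) :=
      (hφ.continuousOn i _ (hmem i)).tendsto.comp (tendsto_nhdsWithin_iff.2
        ⟨hxi i, Eventually.of_forall fun k => ((hs k).x_mem i).1⟩)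
    have h2 := ((by fun_prop : Continuous fun u : Core N n m × Core N n m =>
      φ i x + (inner ℝ u.1.2.2.2 (mulV (G.A i) (x - u.2.1 i))
        - 1 / (N : ℝ) * inner ℝ u.1.2.2.1 (x - u.2.1 i)
        + 1 / p.γ i * (inner ℝ (u.2.1 i - u.1.1 i) (x - u.2.1 i)
          + inner ℝ (mulV (G.A i) (u.2.1 i - u.1.1 i)) (mulV (G.A i) (x - u.2.1 i))))).tendsto
      _).comp hpair
    have h3 := le_of_tendsto_of_tendsto' h1 h2 fun k =>
      hφ.variational_of_argmin ((hs k).x_mem i) hx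
    simpa [hμ, mulV_zero] using h3
  · exact (isClosed_nonnegOrthant m).mem_of_tendsto
      (((by fun_prop : Continuous fun u : Core N n m => u.2.2.2).tendsto z).comp hw')
      (Eventually.of_forall hlam')
  · have h2 := ((by fun_prop : Continuous fun u : Core N n m × Core N n m =>
      inner ℝ (u.1.2.2.2 + (p.δc / N) • ((2 : ℝ) • G.coupling u.2.1 - G.coupling u.1.1)
        - u.2.2.2.2) (l - u.2.2.2.2)).tendsto _).comp hpair
    have h3 := le_of_tendsto' h2 fun k => (hs k).inner_lam_le (hy k) hl
    have e : z.2.2.2 + (p.δc / N) • ((2 : ℝ) • G.coupling z.1 - G.coupling z.1) - z.2.2.2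
        = (p.δc / N) • G.coupling z.1 := by module
    simp only [e, real_inner_smul_left] at h3
    by_contra hc
    push Not at hc
    exact absurd h3 (not_le.2 (mul_pos (div_pos p.δc_mem.1 hN') hc))

/-- The state with given `(x, σ, μ, λ)` and `yᵢ = Aᵢ xᵢ - bᵢ`. -/
def ofCore (G : AggGame N n m) (z : Core N n m) : State N n m :=
  (z.1, WithLp.toLp 2 fun i => mulV (G.A i) (z.1 i) - G.b i, z.2.1, z.2.2.1, z.2.2.2)

theorem continuous_ofCore (G : AggGame N n m) : Continuous G.ofCore := by
  unfold ofCore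
  have := fun i => continuous_mulV (G.A i)
  fun_prop

theorem ofCore_core {w : State N n m} (hy : ∀ i, w.y i = mulV (G.A i) (w.x i) - G.b i) :
    G.ofCore w.core = w := by
  obtain ⟨x, y, s, μ, l⟩ := w
  have : y = WithLp.toLp 2 fun i => mulV (G.A i) (x i) - G.b i := by
    ext i : 1
    exact hy i
  rw [this]
  rfl

theorem IsPotential.tendsto_of_generates (hφ : G.IsPotential φ) (hΩ : G.CompactConvexSlater)
    (hN : 0 < N) {p : StepSizes N} {w₀ : State N n m} (hw₀ : G.IsInit w₀)
    {ω : ℕ → State N n m} (hω : G.Generates p w₀ ω) :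
    ∃ z, G.IsKKT φ z ∧ Tendsto ω atTop (𝓝 (G.ofCore z)) := by
  have hy : ∀ k i, (ω k).y i = mulV (G.A i) ((ω k).x i) - G.b i := by
    intro k
    cases k with
    | zero => rw [hω.1]; exact hw₀.y_eq
    | succ k => exact (hω.2 k).y_eq
  have hqc := G.continuous_precForm_self p
  obtain ⟨c, hc, hcoer⟩ := exists_coercivity_const hqc (G.precForm_smul_smul p)
    fun v hv => G.precForm_self_pos p hN hv
  obtain ⟨z, hz, hlim⟩ := exists_tendsto_of_fejer hqc
    (by simpa using G.precForm_smul_smul p 0 0) hc hcoer (Z := {z | G.IsKKT φ z})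
    (hφ.exists_isKKT hΩ) (u := fun k => (ω k).core)
    (fun z hz k => G.precForm_three_point p (hφ.precForm_step_le hN (hω.2 k) (hy k) hz))
    (fun s w h h' => hφ.isKKT_of_tendsto hΩ hN (fun k => hω.2 (s k)) (fun k => hy (s k)) h h')
  refine ⟨z, hz, (((G.continuous_ofCore).tendsto z).comp hlim).congr fun k => ?_⟩
  exact ofCore_core (hy k)

/-! ### From KKT points to zeros and equilibria. -/

theorem IsKKT.coupling_le {z : Core N n m} (hz : G.IsKKT φ z) (j : Fin m) :
    G.coupling z.1 j ≤ 0 := by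
  have h := hz.compl (z.2.2.2 + EuclideanSpace.single j 1) (fun k => by
    have h1 := hz.lam_mem k
    by_cases hk : k = j
    · subst hk; simp; linarith
    · simpa [hk] using h1)
  simpa [inner_eq_sum_mul] using h

theorem IsKKT.mem_X {z : Core N n m} (hz : G.IsKKT φ z) : z.1 ∈ G.X :=
  ⟨hz.x_mem, hz.coupling_le⟩

theorem IsKKT.complementarity {z : Core N n m} (hz : G.IsKKT φ z) :
    inner ℝ (G.coupling z.1) z.2.2.2 = 0 := by
  have h1 := hz.compl 0 fun _ => le_rfl
  have h2 := hz.compl ((2 : ℝ) • z.2.2.2) fun j => by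
    have := hz.lam_mem j
    simpa using this
  rw [zero_sub, inner_neg_right] at h1
  rw [two_smul, add_sub_cancel_right] at h2
  linarith

/-- Subgradients of the costs that certify the primal-dual optimality conditions. -/
theorem IsPotential.exists_subgradients_of_isKKT (hφ : G.IsPotential φ) {z : Core N n m}
    (hz : G.IsKKT φ z) : ∃ g : Prof N n, (∀ s, g ∈ G.Fe z.1 s) ∧
      ∀ i, ∀ x ∈ G.Ω i,
        0 ≤ inner ℝ (g i) (x - z.1 i) + inner ℝ z.2.2.2 (mulV (G.A i) (x - z.1 i)) := by
  choose g hg hgx using fun i => hφ.exists_subgradient i (z.1 i) (hz.x_mem i)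
    (mulV (G.A i).transpose z.2.2.2) fun x hx => by
      rw [inner_mulV_transpose]
      exact hz.opt i x hx
  refine ⟨WithLp.toLp 2 g, fun s i => hg i s, fun i x hx => ?_⟩
  rw [← inner_mulV_transpose, ← inner_add_left]
  exact hgx i x hx

theorem sum_ofCore_y (z : Core N n m) : ∑ i, (G.ofCore z).y i = G.coupling z.1 := by
  simp [ofCore, coupling, Finset.sum_sub_distrib]

theorem IsPotential.mem_zer_of_isKKT (hφ : G.IsPotential φ) {z : Core N n m}
    (hz : G.IsKKT φ z) : G.ofCore z ∈ zer G.T := by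
  obtain ⟨g, hg, hgx⟩ := hφ.exists_subgradients_of_isKKT hz
  -- On C, differences of y_i equal A_i times differences of x_i, so normality of (-g, -(λ, …, λ))
  -- is the sum of the agents' inequalities. The normal to the orthant is A x - b = ∑ y_i.
  refine ⟨g, hg _, WithLp.toLp 2 (-g, -rep N z.2.2.2), ⟨fun i => ⟨hz.x_mem i, rfl⟩,
    fun c hc => ?_⟩, G.coupling z.1, ⟨hz.lam_mem, hz.compl⟩, ?_⟩
  · have h : inner ℝ (WithLp.toLp 2 (-g, -rep N z.2.2.2) : WithLp 2 (Prof N n × Prof N m))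
        (c - WithLp.toLp 2 ((G.ofCore z).x, (G.ofCore z).y))
        = ∑ i, -(inner ℝ (g i) (c.fst i - z.1 i)
          + inner ℝ z.2.2.2 (mulV (G.A i) (c.fst i - z.1 i))) := by
      rw [WithLp.prod_inner_apply, PiLp.inner_apply, PiLp.inner_apply, ← Finset.sum_add_distrib]
      refine Finset.sum_congr rfl fun i _ => ?_
      have e1 : (c.snd i - (mulV (G.A i) (z.1 i) - G.b i)) = mulV (G.A i) (c.fst i - z.1 i) := by
        rw [(hc i).2, mulV_sub]; abel
      rw [← e1]
      simp only [ofCore, WithLp.ofLp_sub, Prod.fst_sub, Prod.snd_sub, PiLp.sub_apply,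
        PiLp.neg_apply, inner_neg_left, rep]
      rw [neg_add]
      rfl
    rw [h]
    exact Finset.sum_nonpos fun i _ => neg_nonpos.2 (hgx i _ (hc i).1)
  · have e1 : (G.ofCore z).μ = 0 := hz.μ_eq
    have e2 : (G.ofCore z).σ = avg (G.ofCore z).x := hz.σ_eq
    have e3 : (G.ofCore z).lam = z.2.2.2 := rfl
    have e4 : rep N (0 : Vec n) = 0 := rfl
    rw [e1, e2, e3, sum_ofCore_y, e4]
    simp
    rfl

theorem sum_erase_sub_eq (x : Prof N n) (i : Fin N) :
    ∑ k ∈ Finset.univ.erase i, (G.b k - mulV (G.A k) (x k))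
      = mulV (G.A i) (x i) - G.b i - G.coupling x := by
  have h := Finset.add_sum_erase Finset.univ (fun k => G.b k - mulV (G.A k) (x k))
    (Finset.mem_univ i)
  rw [eq_sub_of_add_eq' h, coupling, Finset.sum_sub_distrib]
  abel

/-- The constraint of agent i says that the coupling stays nonpositive after its deviation. Pairing
with λ and using complementarity gives ⟪λ, A_i(x - x_i)⟫ ≤ 0, hence ⟪g_i, x - x_i⟫ ≥ 0. The shared λ
gives the joint variational inequality by summation. -/
theorem IsPotential.isVGAE_of_isKKT (hφ : G.IsPotential φ) (hfin : G.FiniteCosts)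
    {z : Core N n m} (hz : G.IsKKT φ z) : G.IsVGAE z.1 := by
  obtain ⟨g, hg, hgx⟩ := hφ.exists_subgradients_of_isKKT hz
  have hcs : inner ℝ z.2.2.2 (G.coupling z.1) = 0 := by
    rw [real_inner_comm]; exact hz.complementarity
  have hle : ∀ v : Vec m, (∀ j, v j ≤ 0) → inner ℝ z.2.2.2 v ≤ 0 := by
    intro v hv
    rw [inner_eq_sum_mul]
    exact Finset.sum_nonpos fun j _ => mul_nonpos_of_nonneg_of_nonpos (hz.lam_mem j) (hv j)
  refine ⟨⟨hz.mem_X, fun i x hx => ?_⟩, hz.mem_X, g, hg _, fun x hx => ?_⟩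
  · have h1 := (hg (avg z.1) i).2 x (interior_subset (hfin i (avg z.1) hx.1))
    have h2 := hgx i x hx.1
    have h3 := hle (G.coupling z.1 + mulV (G.A i) (x - z.1 i)) (fun j => by
      have := hx.2 j
      rw [sum_erase_sub_eq] at this
      simp only [mulV_sub, PiLp.add_apply, PiLp.sub_apply] at this ⊢
      linarith)
    rw [inner_add_right, hcs] at h3
    refine le_trans ?_ h1
    have h4 : (0 : EReal) ≤ ((inner ℝ (g i) (x - z.1 i) : ℝ) : EReal) := by
      exact_mod_cast (by linarith : (0 : ℝ) ≤ inner ℝ (g i) (x - z.1 i))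
    simpa using add_le_add_right h4 (G.f i (z.1 i) (avg z.1))
  · have h1 := Finset.sum_nonneg fun i (_ : i ∈ Finset.univ) => hgx i _ (hx.1 i)
    rw [Finset.sum_add_distrib, ← inner_sum, ← coupling_sub, inner_sub_right, hcs] at h1
    have h2 := hle _ hx.2
    rw [PiLp.inner_apply]
    simp only [PiLp.sub_apply]
    linarith

end AggGame

end

theorem theorem1 {N n m : ℕ} (hN : 0 < N) (G : AggGame N n m)
    (hΩ : G.CompactConvexSlater) (hconv : G.ConvexCosts) (hfin : G.FiniteCosts)
    (hmono : MaximallyMonotone G.FeFc)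
    (p : StepSizes N) (w₀ : State N n m) (hw₀ : G.IsInit w₀) :
    (∃! ω : ℕ → State N n m, G.Generates p w₀ ω) ∧
    ∀ ω : ℕ → State N n m, G.Generates p w₀ ω →
      ∃ wstar ∈ zer G.T, Tendsto ω atTop (𝓝 wstar) ∧ G.IsVGAE wstar.x := by
  obtain ⟨φ, hφ⟩ := G.exists_isPotential hΩ hconv hfin hmono
  refine ⟨hφ.existsUnique_generates hΩ p w₀, fun ω hω => ?_⟩
  obtain ⟨z, hz, hlim⟩ := hφ.tendsto_of_generates hΩ hN hw₀ hω
  exact ⟨G.ofCore z, hφ.mem_zer_of_isKKT hz, hlim, hφ.isVGAE_of_isKKT hfin hz⟩
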